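/- Define $m_n(q)$ ($n\ge 0$) by the formal continued fraction $$\sum_{n\ge 0} m_n(q)z^n=\cfrac{1}{1-\cfrac{[1]_q z^2}{1-\cfrac{[2]_q z^2}{1-\ddots}}},\qquad [i]_q=\frac{1-q^i}{1-q}$$ (the moments of the $q$-semicircular law), define the cumulants $k_n(q)$ ($n\ge1$) by $$\sum_{n\ge 1}k_n(q)\frac{z^n}{n!}=\log\Big(\sum_{n\ge 0}m_n(q)\frac{z^n}{n!}\Big)$$ as formal power series in $z$, and for $n\ge 1$ put $\tilde k_{2n}(q)=k_{2n}(q)/(q-1)^{n-1}$. Here $q\neq 1$ is an element of any field of characteristic $0$ (for instance a real number, or an indeterminate $q\in\mathbb{Q}(q)$). A matching $\sigma$ of $\{1,\dots,2n\}$ is a set partition all of whose blocks (arches) have size $2$; it is connected if no nonempty interval of $\{1,\dots,2n\}$ other than $\{1,\dots,2n\}$ itself is a union of blocks of $\sigma$. Let $\mathcal{M}^c(2n)$ be the set of connected matchings of $\{1,\dots,2n\}$. The crossing graph $G(\sigma)$ has the arches of $\sigma$ as vertices, two arches being adjacent if and only if they can be written $\{i,j\}$ and $\{k,\ell\}$ with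 $i<k<j<\ell$. For a finite graph $G=(V,E)$, let $$T_G(x,y)=\sum_{A\subseteq E}(x-1)^{r(E)-r(A)}(y-1)^{|A|-r(A)}$$ be its Tutte polynomial, where $r(A)$ is $|V|$ minus the number of connected components of $(V,A)$. **Theorem.** For every $n\ge 1$, $$\tilde k_{2n}(q)=\sum_{\sigma\in\mathcal{M}^c(2n)}T_{G(\sigma)}(1,q).$$ In particular $\tilde k_{2n}(q)$ is a polynomial in $q$ with nonnegative coefficients: there is a polynomial $P_n\in\mathbb{Z}[X]$ with nonnegative coefficients such that $\tilde k_{2n}(q)=P_n(q)$ for all such $q$. -/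

import Mathlib

open scoped BigOperators

namespace QSemicircular

section Cumulants

variable {K : Type*} [Field K]

/-- The `q`-integer `[i]_q = (1 - q^i) / (1 - q)`; it is used for `q ≠ 1` only. -/
noncomputable def qInt (q : K) (i : ℕ) : K := (1 - q ^ i) / (1 - q)

/-- `convergent q N i` is the continued fraction
`1 / (1 - [i+1]_q z^2 / (1 - [i+2]_q z^2 / (⋯ / (1 - [i+N]_q z^2))))`
with `N` levels, as a formal power series in `z`. Every denominator has constant term `1`, so each
inverse is a genuine inverse of power series. -/
noncomputable def convergent (q : K) : ℕ → ℕ → PowerSeries K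
  | 0, _ => 1
  | N + 1, i =>
      (1 - PowerSeries.C (qInt q (i + 1)) * PowerSeries.X ^ 2 * convergent q N (i + 1))⁻¹

/-- The value of the infinite continued fraction
`1 / (1 - [i+1]_q z^2 / (1 - [i+2]_q z^2 / (1 - ⋯)))`, as a formal power series in `z`:
the coefficient of `z^n` is the one of the convergents with at least `n` levels, which all agree
there (see `coeff_convergent`). -/
noncomputable def tail (q : K) (i : ℕ) : PowerSeries K :=
  PowerSeries.mk fun n => PowerSeries.coeff n (convergent q n i)

/-- The `n`th moment `m_n(q)` of the `q`-semicircular law: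
`∑ m_n(q) z^n = 1 / (1 - [1]_q z^2 / (1 - [2]_q z^2 / (1 - ⋯)))`. -/
noncomputable def moment (q : K) (n : ℕ) : K := PowerSeries.coeff n (tail q 0)

/-- The exponential generating function `∑ m_n(q) z^n / n!` of the moments. -/
noncomputable def momentEGF (q : K) : PowerSeries K :=
  PowerSeries.mk fun n => moment q n / (n.factorial : K)

/-- The `n`th classical cumulant `k_n(q)`, defined by
`∑_{n ≥ 1} k_n(q) z^n / n! = log (∑_{n ≥ 0} m_n(q) z^n / n!)`. -/
noncomputable def cumulant [CharZero K] (q : K) (n : ℕ) : K :=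
  (n.factorial : K) * PowerSeries.coeff n (PowerSeries.logOf (momentEGF q))

/-- The normalized cumulant `k_{2n}(q) / (q - 1)^(n - 1)`, for `n ≥ 1` and `q ≠ 1`. -/
noncomputable def normalizedCumulant [CharZero K] (q : K) (n : ℕ) : K :=
  cumulant q (2 * n) / (q - 1) ^ (n - 1)

theorem convergent_succ_mul (q : K) (N i : ℕ) :
    convergent q (N + 1) i *
      (1 - PowerSeries.C (qInt q (i + 1)) * PowerSeries.X ^ 2 * convergent q N (i + 1)) = 1 := by
  rw [convergent]
  exact PowerSeries.inv_mul_cancel _ (by simp)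

theorem X_pow_dvd_convergent_sub (q : K) (N : ℕ) : ∀ i M : ℕ, N ≤ M →
    (PowerSeries.X : PowerSeries K) ^ (2 * N + 1) ∣
      PowerSeries.X * (convergent q M i - convergent q N i) := by
  induction N with
  | zero => intro i M _; simp
  | succ N ih =>
    intro i M hM
    obtain ⟨M, rfl⟩ : ∃ M', M = M' + 1 := ⟨M - 1, by omega⟩
    obtain ⟨D, hD⟩ := ih (i + 1) M (by omega)
    have h1 := convergent_succ_mul q M i
    have h2 := convergent_succ_mul q N i
    set c := PowerSeries.C (qInt q (i + 1))
    set A := convergent q (M + 1) i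
    set B := convergent q (N + 1) i
    set a := convergent q M (i + 1)
    set b := convergent q N (i + 1)
    refine ⟨A * B * c * D, ?_⟩
    have : A - B = A * B * c * PowerSeries.X ^ 2 * (a - b) := by
      linear_combination B * h1 - A * h2
    rw [this]
    linear_combination (A * B * c * PowerSeries.X ^ 2) * hD

/-- The convergents stabilize: all those with at least `n` levels have the same coefficient of
`z^n`. -/
theorem coeff_convergent (q : K) (i n N : ℕ) (h : n ≤ N) :
    PowerSeries.coeff n (convergent q N i) = PowerSeries.coeff n (tail q i) := by
  rw [tail, PowerSeries.coeff_mk]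
  rcases n with _ | n
  · have key : ∀ N i, PowerSeries.constantCoeff (convergent q N i) = 1 := by
      intro N i
      cases N <;> simp [convergent]
    simp [key]
  · have h0 := X_pow_dvd_convergent_sub q (n + 1) i N h
    have h1 := PowerSeries.X_pow_dvd_iff.mp h0 (n + 1 + 1) (by omega)
    rw [PowerSeries.coeff_succ_X_mul, map_sub, sub_eq_zero] at h1
    exact h1

end Cumulants

section Matchings

/-- A matching of `{1, …, n}`: a set partition all of whose blocks (the arches) have size 2. -/
def IsMatching {n : ℕ} (σ : Finpartition (Finset.Icc 1 n)) : Prop :=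
  ∀ b ∈ σ.parts, b.card = 2

/-- A connected set partition of `{1, …, n}`: no proper (nonempty, not the whole set) interval
`{a, …, b}` of `{1, …, n}` is a union of blocks. -/
def IsConnected {n : ℕ} (π : Finpartition (Finset.Icc 1 n)) : Prop :=
  ∀ a b : ℕ, 1 ≤ a → a ≤ b → b ≤ n → Finset.Icc a b ≠ Finset.Icc 1 n →
    ¬ ∃ S ⊆ π.parts, S.biUnion id = Finset.Icc a b

open Classical in
/-- The finite set of connected matchings of `{1, …, 2n}`. -/
noncomputable def connectedMatchings (n : ℕ) : Finset (Finpartition (Finset.Icc 1 (2 * n))) :=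
  Finset.univ.filter fun σ => IsMatching σ ∧ IsConnected σ

/-- The arches `a = {i, j}` and `b = {k, l}` satisfy `i < k < j < l`. -/
def Crosses (a b : Finset ℕ) : Prop :=
  ∃ i j k l : ℕ, a = {i, j} ∧ b = {k, l} ∧ i < k ∧ k < j ∧ j < l

/-- The crossing graph of a matching: the vertices are the arches, and two arches are adjacent when
they cross. -/
def crossingGraph {n : ℕ} (σ : Finpartition (Finset.Icc 1 n)) : SimpleGraph σ.parts where
  Adj a b := Crosses a b ∨ Crosses b a
  symm := ⟨fun _ _ h => h.symm⟩
  loopless := ⟨by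
    rintro ⟨a, _⟩ h
    obtain ⟨i, j, k, l, h1, h2, h3, h4, h5⟩ : Crosses a a := h.elim id id
    have : i ∈ ({k, l} : Finset ℕ) := by rw [← h2, h1]; simp
    simp only [Finset.mem_insert, Finset.mem_singleton] at this
    omega⟩

end Matchings

section Tutte

variable {V : Type*} [Fintype V]

/-- The rank of a set `A` of edges: the number of vertices minus the number of connected components
of the spanning subgraph with edge set `A`. -/
noncomputable def edgeRank (A : Set (Sym2 V)) : ℕ :=
  Fintype.card V - Nat.card (SimpleGraph.fromEdgeSet A).ConnectedComponent

open Classical in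
/-- The Tutte polynomial
`T_G(x, y) = ∑_{A ⊆ E} (x - 1)^(r(E) - r(A)) (y - 1)^(|A| - r(A))`,
with variables `x = X 0` and `y = X 1`. One has `r(A) ≤ r(E)` and `r(A) ≤ |A|`, so no subtraction
is truncated. -/
noncomputable def tutte (G : SimpleGraph V) : MvPolynomial (Fin 2) ℤ :=
  ∑ A ∈ G.edgeFinset.powerset,
    (MvPolynomial.X 0 - 1) ^ (edgeRank G.edgeSet - edgeRank (A : Set (Sym2 V))) *
      (MvPolynomial.X 1 - 1) ^ (A.card - edgeRank (A : Set (Sym2 V)))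

end Tutte

end QSemicircular

/-!
Write `cr(σ)` for the number of edges of the crossing graph of a matching `σ`.

*Moments.* Reading the points from left to right and keeping track of the number of pending arches
turns matchings weighted by `q ^ cr(σ)` into lattice paths (`sum_completions`), whose generating
functions are products of tails of the continued fraction (`pathGF`). Hence
`m_n(q) = ∑ q ^ cr(σ)` over the matchings of any `n` points (`sum_matchings`).

*Cumulants.* Expanding `q = 1 + (q - 1)` for each crossing, `q ^ cr(σ)` becomes the sum of
`(q - 1) ^ |A|` over all sets `A` of crossings. The component of a fixed arch for the graph `(σ, A)`
splits off a set of points, a matching of it and a connected subgraph of the crossing graph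
(`pow_card_edgesIn`, `sum_matchings_eq_sum_component`). The resulting recursion is the
moment-cumulant recursion `moment_card_eq`, which comes from the differential equation of the
logarithm. So `k_n(q)` is the sum of `(q - 1) ^ |A|` over the pairs of a matching `σ` and a set `A`
of crossings for which `(σ, A)` is connected (`matchingConnWeight_eq_cumulant`).

*Tutte polynomials.* Such an `A` exists only if the crossing graph is connected, that is, if the
matching is connected (`isConnected_of_joins`, `joins_of_isConnected`), and then the sum over `A` is
`(q - 1) ^ (|σ| - 1) T(1, q)` (`connWeight_eq_tutte`).

*Nonnegativity.* Sorting the connected graphs by the layers of a breadth-first search, each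
vertex `s` with `d` neighbours in the previous layer contributes
`q ^ d - 1 = (q - 1) (1 + q + ⋯ + q ^ (d - 1))`, and the edges inside a layer contribute powers of
`q`. This exhibits the sum over `A` as `(q - 1) ^ (|σ| - 1)` times a polynomial with coefficients
in `ℕ` (`layerPoly`, `exists_connWeight_eq`).
-/

open scoped BigOperators

namespace QSemicircular

/-! ### The continued fraction and the moment-cumulant recursion -/

section PathGF

variable {K : Type*} [Field K]

theorem qInt_eq_sum {q : K} (hq : q ≠ 1) (i : ℕ) : qInt q i = ∑ j ∈ Finset.range i, q ^ j := by
  rw [qInt, geom_sum_eq hq, ← neg_sub, ← neg_sub q 1, neg_div_neg_eq]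

theorem tail_eq (q : K) (i : ℕ) :
    tail q i = 1 + PowerSeries.C (qInt q (i + 1)) * PowerSeries.X ^ 2 *
      (tail q (i + 1) * tail q i) := by
  have h : ∀ N, convergent q (N + 1) i = 1 + PowerSeries.C (qInt q (i + 1)) *
      (PowerSeries.X ^ 2 * (convergent q N (i + 1) * convergent q (N + 1) i)) := fun N => by
    linear_combination convergent_succ_mul q N i
  ext n
  rw [mul_assoc, ← coeff_convergent q i n (n + 1) (by omega), h n, map_add, map_add,
    PowerSeries.coeff_C_mul, PowerSeries.coeff_C_mul, PowerSeries.coeff_X_pow_mul',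
    PowerSeries.coeff_X_pow_mul']
  split_ifs
  · rw [PowerSeries.coeff_mul, PowerSeries.coeff_mul]
    congr 2
    refine Finset.sum_congr rfl fun p hp => ?_
    have := Finset.HasAntidiagonal.mem_antidiagonal.mp hp
    rw [coeff_convergent q (i + 1) p.1 n (by omega), coeff_convergent q i p.2 (n + 1) (by omega)]
  · rfl

/-- The generating function of weighted lattice paths with `n` steps `±1` from height `h` down to
height `0`, staying nonnegative, in which a down step from height `i` has weight `[i]_q`. The first
passage decomposition expresses it by the tails of the continued fraction. -/
noncomputable def pathGF (q : K) (h : ℕ) : PowerSeries K :=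
  PowerSeries.C (∏ i ∈ Finset.range h, qInt q (i + 1)) * PowerSeries.X ^ h *
    ∏ i ∈ Finset.range (h + 1), tail q i

theorem pathGF_zero (q : K) : pathGF q 0 = 1 + PowerSeries.X * pathGF q 1 := by
  have h := tail_eq q 0
  simp only [pathGF, Finset.prod_range_succ, Finset.prod_range_zero, map_one, one_mul, pow_zero,
    pow_one, zero_add] at h ⊢
  linear_combination h

theorem pathGF_succ (q : K) (h : ℕ) : pathGF q (h + 1) =
    PowerSeries.X * (PowerSeries.C (qInt q (h + 1)) * pathGF q h + pathGF q (h + 2)) := by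
  have e := tail_eq q (h + 1)
  simp only [pathGF, Finset.prod_range_succ _ (h + 1 + 1), Finset.prod_range_succ _ (h + 1),
    Finset.prod_range_succ _ h, map_mul] at e ⊢
  linear_combination (PowerSeries.C (∏ i ∈ Finset.range h, qInt q (i + 1)) *
    PowerSeries.C (qInt q (h + 1)) * PowerSeries.X ^ (h + 1) *
    (∏ i ∈ Finset.range h, tail q i) * tail q h) * e

/-- The weighted number of paths counted by `pathGF` with `n` steps from height `h`. -/
noncomputable def pathSum (q : K) (n h : ℕ) : K := PowerSeries.coeff n (pathGF q h)

theorem pathSum_zero (q : K) (h : ℕ) : pathSum q 0 h = if h = 0 then 1 else 0 := by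
  rcases h with _ | h
  · simp [pathSum, pathGF_zero]
  · rw [pathSum, pathGF_succ]; simp

theorem pathSum_succ (q : K) (n h : ℕ) :
    pathSum q (n + 1) h = pathSum q n (h + 1) + qInt q h * pathSum q n (h - 1) := by
  rcases h with _ | h
  · simp [pathSum, pathGF_zero, PowerSeries.coeff_succ_X_mul, qInt, PowerSeries.coeff_one]
  · rw [pathSum, pathGF_succ, PowerSeries.coeff_succ_X_mul, add_comm]; simp [pathSum]

theorem moment_eq_pathSum (q : K) (n : ℕ) : moment q n = pathSum q n 0 := by
  simp [moment, pathSum, pathGF]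

theorem moment_zero (q : K) : moment q 0 = 1 := by
  simp [moment_eq_pathSum, pathSum_zero]

variable [CharZero K]

/-- The logarithm `L` of a power series `f` with constant term `1` satisfies `f' = L' f`. -/
theorem derivative_eq_derivative_logOf_mul {f : PowerSeries K}
    (hf : PowerSeries.constantCoeff f = 1) :
    PowerSeries.derivative K f = PowerSeries.derivative K (PowerSeries.logOf f) * f := by
  have hs : PowerSeries.HasSubst (f - 1) :=
    PowerSeries.HasSubst.of_constantCoeff_zero' (by simp [hf])
  have hd : PowerSeries.derivative K (PowerSeries.log K) * (1 + PowerSeries.X) = 1 := by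
    rw [PowerSeries.deriv_log, mul_add, mul_one]
    ext n
    rcases n with _ | n
    · simp
    · simp [PowerSeries.coeff_succ_mul_X, PowerSeries.coeff_one, pow_succ]
  have h1 := congrArg (PowerSeries.subst (f - 1)) hd
  rw [PowerSeries.subst_mul hs, PowerSeries.subst_add hs, PowerSeries.subst_X hs,
    ← PowerSeries.coe_substAlgHom hs, map_one, PowerSeries.coe_substAlgHom hs] at h1
  rw [PowerSeries.logOf_eq, PowerSeries.derivative_subst hs, map_sub,
    PowerSeries.derivative_one]
  linear_combination (-(PowerSeries.derivative K f)) * h1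

/-- The recursion between moments and cumulants obtained by singling out the block of one point in
the moment-cumulant formula. -/
theorem moment_succ (q : K) (n : ℕ) : moment q (n + 1) =
    ∑ j ∈ Finset.range (n + 1), (n.choose j : K) * cumulant q (j + 1) * moment q (n - j) := by
  have h := congrArg (PowerSeries.coeff n) (derivative_eq_derivative_logOf_mul (f := momentEGF q)
    (by simp [momentEGF, ← PowerSeries.coeff_zero_eq_constantCoeff_apply, moment_zero]))
  have fac : ∀ k : ℕ, (k.factorial : K) ≠ 0 := fun k => by exact_mod_cast k.factorial_ne_zero
  rw [PowerSeries.coeff_mul, Finset.Nat.sum_antidiagonal_eq_sum_range_succ_mk,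
    PowerSeries.coeff_derivative] at h
  have h2 : moment q (n + 1) = n.factorial *
      (PowerSeries.coeff (n + 1) (momentEGF q) * ((n : K) + 1)) := by
    have := fac (n + 1)
    rw [momentEGF, PowerSeries.coeff_mk]
    rw [Nat.factorial_succ] at this ⊢
    push_cast at this ⊢
    have := fac n
    field_simp
  rw [h2, h, Finset.mul_sum]
  refine Finset.sum_congr rfl fun j hj => ?_
  have hj : j ≤ n := by simpa [Nat.lt_succ_iff] using hj
  have h3 : (n.factorial : K) = n.choose j * j.factorial * (n - j).factorial := by
    exact_mod_cast (Nat.choose_mul_factorial_mul_factorial hj).symm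
  have := fac (n - j)
  rw [PowerSeries.coeff_derivative, momentEGF, PowerSeries.coeff_mk, cumulant, h3,
    Nat.factorial_succ, momentEGF]
  push_cast
  field_simp

end PathGF

/-! ### Edges inside a set of vertices -/

section Edges

variable {V : Type*} (G : SimpleGraph V)

open Classical in
/-- The edges of `G` with both ends in `U`. -/
noncomputable def edgesIn (U : Finset V) : Finset (Sym2 V) := U.sym2.filter (· ∈ G.edgeSet)

open Classical in
/-- The number of neighbours of `v` in `U`. -/
noncomputable def degIn (U : Finset V) (v : V) : ℕ := (U.filter (G.Adj v)).card

theorem mk_mem_edgesIn {U : Finset V} {x y : V} :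
    s(x, y) ∈ edgesIn G U ↔ x ∈ U ∧ y ∈ U ∧ G.Adj x y := by
  simp [edgesIn, and_assoc]

theorem edgesIn_mono {U W : Finset V} (h : U ⊆ W) : edgesIn G U ⊆ edgesIn G W := by
  classical
  exact Finset.filter_subset_filter _ (Finset.sym2_mono h)

theorem disjoint_edgesIn {U W : Finset V} (h : Disjoint U W) :
    Disjoint (edgesIn G U) (edgesIn G W) := by
  rw [Finset.disjoint_left]
  intro e
  induction e with | _ x y
  rw [mk_mem_edgesIn, mk_mem_edgesIn]
  exact fun h1 h2 => Finset.disjoint_left.mp h h1.1 h2.1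

variable [DecidableEq V]

theorem degIn_union {U W : Finset V} (h : Disjoint U W) (v : V) :
    degIn G (U ∪ W) v = degIn G U v + degIn G W v := by
  classical
  rw [degIn, Finset.filter_union, Finset.card_union_of_disjoint
    (Finset.disjoint_filter_filter h), degIn, degIn]

theorem card_edgesIn_insert {U : Finset V} {v : V} (h : v ∉ U) :
    (edgesIn G (insert v U)).card = (edgesIn G U).card + degIn G U v := by
  classical
  have e : edgesIn G (insert v U) =
      edgesIn G U ∪ (U.filter (G.Adj v)).image (fun w => s(v, w)) := by
    ext e
    induction e with | _ x y
    simp only [mk_mem_edgesIn, Finset.mem_union, Finset.mem_image, Finset.mem_filter,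
      Finset.mem_insert, Sym2.eq_iff]
    constructor
    · rintro ⟨rfl | hx, rfl | hy, ha⟩
      · exact (G.loopless.irrefl _ ha).elim
      · exact Or.inr ⟨y, ⟨hy, ha⟩, Or.inl ⟨rfl, rfl⟩⟩
      · exact Or.inr ⟨x, ⟨hx, ha.symm⟩, Or.inr ⟨rfl, rfl⟩⟩
      · exact Or.inl ⟨hx, hy, ha⟩
    · rintro (⟨hx, hy, ha⟩ | ⟨w, ⟨hw, ha⟩, ⟨rfl, rfl⟩ | ⟨rfl, rfl⟩⟩)
      · exact ⟨Or.inr hx, Or.inr hy, ha⟩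
      · exact ⟨Or.inl rfl, Or.inr hw, ha⟩
      · exact ⟨Or.inr hw, Or.inl rfl, ha.symm⟩
  rw [e, Finset.card_union_of_disjoint, Finset.card_image_of_injective, degIn]
  · exact fun a b hab => Sym2.congr_right.mp hab
  · rw [Finset.disjoint_right]
    simp only [Finset.mem_image, Finset.mem_filter]
    rintro _ ⟨w, _, rfl⟩ hw
    exact h ((mk_mem_edgesIn G).mp hw).1

theorem card_edgesIn_union {S W : Finset V} (h : Disjoint S W) :
    (edgesIn G (S ∪ W)).card =
      (edgesIn G S).card + (edgesIn G W).card + ∑ w ∈ W, degIn G S w := by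
  induction W using Finset.induction_on with
  | empty => simp [edgesIn]
  | insert w W hw ih =>
    rw [Finset.disjoint_insert_right] at h
    rw [Finset.union_insert, card_edgesIn_insert G (by simp [hw, h.1]), ih h.2,
      card_edgesIn_insert G hw, Finset.sum_insert hw, degIn_union G h.2]
    ring

end Edges

/-! ### Connected spanning edge sets -/

section Connected

variable {V : Type*} (G : SimpleGraph V) {R : Type*} [CommRing R] (y : R)

/-- The edge set `A` joins any two vertices of `U`. -/
def Joins (A : Finset (Sym2 V)) (U : Finset V) : Prop :=
  ∀ u ∈ U, ∀ v ∈ U, (SimpleGraph.fromEdgeSet (A : Set (Sym2 V))).Reachable u v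

open Classical in
/-- The sum of `(y - 1) ^ |A|` over the sets `A` of edges inside `U` for which `(U, A)` is
connected. -/
noncomputable def connWeight (U : Finset V) : R :=
  ∑ A ∈ (edgesIn G U).powerset with Joins A U, (y - 1) ^ A.card

/-- A set of vertices closed under adjacency is closed under reachability. -/
theorem mem_of_reachable {H : SimpleGraph V} {p : V → Prop}
    (hp : ∀ x y, H.Adj x y → p x → p y) {u v : V} (h : H.Reachable u v) (hu : p u) : p v := by
  rw [SimpleGraph.reachable_iff_reflTransGen] at h
  induction h with
  | refl => exact hu
  | tail _ hab ih => exact hp _ _ hab ih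

open Classical in
/-- The vertices of `U` that `A` joins to `v`. -/
noncomputable def componentIn (A : Finset (Sym2 V)) (U : Finset V) (v : V) : Finset V :=
  U.filter fun u => (SimpleGraph.fromEdgeSet (A : Set (Sym2 V))).Reachable v u

variable {G} [DecidableEq V]

theorem subset_edgesIn_componentIn {A : Finset (Sym2 V)} {U : Finset V} (hA : A ⊆ edgesIn G U)
    (v : V) :
    A ⊆ edgesIn G (componentIn A U v) ∪ edgesIn G (U \ componentIn A U v) := by
  classical
  intro e he
  induction e with | _ x y
  have h := (mk_mem_edgesIn G).mp (hA he)
  have ha : (SimpleGraph.fromEdgeSet (A : Set (Sym2 V))).Adj x y := by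
    rw [SimpleGraph.fromEdgeSet_adj]; exact ⟨he, h.2.2.ne⟩
  rw [Finset.mem_union, mk_mem_edgesIn, mk_mem_edgesIn]
  by_cases hx : (SimpleGraph.fromEdgeSet (A : Set (Sym2 V))).Reachable v x
  · have hy := hx.trans ha.reachable
    simp [componentIn, h, hx, hy]
  · have hy : ¬ (SimpleGraph.fromEdgeSet (A : Set (Sym2 V))).Reachable v y :=
      fun hy => hx (hy.trans ha.symm.reachable)
    simp [componentIn, h, hx, hy]

theorem joins_inter_edgesIn_componentIn {A : Finset (Sym2 V)} {U : Finset V}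
    (hA : A ⊆ edgesIn G U) {v : V} (hv : v ∈ U) :
    Joins (A ∩ edgesIn G (componentIn A U v)) (componentIn A U v) := by
  classical
  have key : ∀ u ∈ componentIn A U v, (SimpleGraph.fromEdgeSet
      ((A ∩ edgesIn G (componentIn A U v) : Finset (Sym2 V)) : Set (Sym2 V))).Reachable v u := by
    intro u hu
    have hu' := (Finset.mem_filter.mp hu).2
    refine (mem_of_reachable (p := fun u => u ∈ componentIn A U v ∧ (SimpleGraph.fromEdgeSet
      ((A ∩ edgesIn G (componentIn A U v) : Finset (Sym2 V)) : Set (Sym2 V))).Reachable v u)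
      ?_ hu' ⟨by simp [componentIn, hv], SimpleGraph.Reachable.rfl⟩).2
    rintro x y hxy ⟨hx, hr⟩
    rw [SimpleGraph.fromEdgeSet_adj] at hxy
    have h := (mk_mem_edgesIn G).mp (hA hxy.1)
    have hx' := (Finset.mem_filter.mp hx).2
    have hy : y ∈ componentIn A U v := Finset.mem_filter.mpr ⟨h.2.1, hx'.trans
      (SimpleGraph.Adj.reachable ((SimpleGraph.fromEdgeSet_adj _).mpr hxy))⟩
    refine ⟨hy, hr.trans (SimpleGraph.Adj.reachable ((SimpleGraph.fromEdgeSet_adj _).mpr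
      ⟨?_, hxy.2⟩))⟩
    exact Finset.mem_coe.mpr (Finset.mem_inter.mpr ⟨hxy.1, (mk_mem_edgesIn G).mpr ⟨hx, hy, h.2.2⟩⟩)
  exact fun a ha b hb => (key a ha).symm.trans (key b hb)

theorem componentIn_union {A₁ A₂ : Finset (Sym2 V)} {B U : Finset V} (hB : B ⊆ U) {v : V}
    (hv : v ∈ B) (h₁ : A₁ ⊆ edgesIn G B) (hj : Joins A₁ B) (h₂ : A₂ ⊆ edgesIn G (U \ B)) :
    componentIn (A₁ ∪ A₂) U v = B := by
  classical
  ext u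
  constructor
  · intro hu
    refine mem_of_reachable (p := (· ∈ B)) ?_ (Finset.mem_filter.mp hu).2 hv
    intro x y hxy hx
    rw [SimpleGraph.fromEdgeSet_adj, Finset.mem_coe, Finset.mem_union] at hxy
    rcases hxy.1 with h | h
    · exact ((mk_mem_edgesIn G).mp (h₁ h)).2.1
    · exact absurd hx (Finset.mem_sdiff.mp ((mk_mem_edgesIn G).mp (h₂ h)).1).2
  · intro hu
    refine Finset.mem_filter.mpr ⟨hB hu, (hj v hv u hu).mono ?_⟩
    exact SimpleGraph.fromEdgeSet_mono (by simp)

variable (G)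

/-- Expanding `y = 1 + (y - 1)` for every edge and collecting the edge sets by the component of a
fixed vertex `v`. -/
theorem pow_card_edgesIn {U : Finset V} {v : V} (hv : v ∈ U) :
    y ^ (edgesIn G U).card =
      ∑ B ∈ U.powerset with v ∈ B, connWeight G y B * y ^ (edgesIn G (U \ B)).card := by
  classical
  have expand : ∀ E : Finset (Sym2 V), y ^ E.card = ∑ A ∈ E.powerset, (y - 1) ^ A.card := by
    intro E
    have := Finset.prod_add_one (f := fun _ => y - 1) E
    simpa using this
  rw [expand, ← Finset.sum_fiberwise_of_maps_to (t := U.powerset.filter (v ∈ ·))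
    (g := fun A => componentIn A U v)]
  · refine Finset.sum_congr rfl fun B hB => ?_
    obtain ⟨hBU, hvB⟩ : B ⊆ U ∧ v ∈ B := by simpa using hB
    have hd : Disjoint (edgesIn G B) (edgesIn G (U \ B)) :=
      disjoint_edgesIn G Finset.disjoint_sdiff
    rw [connWeight, expand, Finset.sum_mul_sum, ← Finset.sum_product']
    refine Finset.sum_bij' (fun A _ => (A ∩ edgesIn G B, A ∩ edgesIn G (U \ B)))
      (fun p _ => p.1 ∪ p.2) ?_ ?_ ?_ ?_ ?_
    · intro A hA
      obtain ⟨hAU, rfl⟩ : A ⊆ edgesIn G U ∧ componentIn A U v = B := by simpa using hA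
      simp only [Finset.mem_product, Finset.mem_filter, Finset.mem_powerset]
      exact ⟨⟨Finset.inter_subset_right, joins_inter_edgesIn_componentIn hAU hv⟩,
        Finset.inter_subset_right⟩
    · rintro ⟨A₁, A₂⟩ hA
      simp only [Finset.mem_product, Finset.mem_filter, Finset.mem_powerset] at hA ⊢
      exact ⟨Finset.union_subset (hA.1.1.trans (edgesIn_mono G hBU))
        (hA.2.trans (edgesIn_mono G Finset.sdiff_subset)),
        componentIn_union hBU hvB hA.1.1 hA.1.2 hA.2⟩
    · intro A hA
      obtain ⟨hAU, rfl⟩ : A ⊆ edgesIn G U ∧ componentIn A U v = B := by simpa using hA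
      simp only
      rw [← Finset.inter_union_distrib_left]
      exact Finset.inter_eq_left.mpr (subset_edgesIn_componentIn hAU v)
    · rintro ⟨A₁, A₂⟩ hA
      simp only [Finset.mem_product, Finset.mem_filter, Finset.mem_powerset] at hA
      have h1 : A₁ ∩ edgesIn G (U \ B) = ∅ :=
        Finset.disjoint_iff_inter_eq_empty.mp (hd.mono_left hA.1.1)
      have h2 : A₂ ∩ edgesIn G B = ∅ :=
        Finset.disjoint_iff_inter_eq_empty.mp (hd.symm.mono_left hA.2)
      simp [Finset.union_inter_distrib_right, h1, h2, Finset.inter_eq_left.mpr hA.1.1,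
        Finset.inter_eq_left.mpr hA.2]
    · intro A hA
      obtain ⟨hAU, rfl⟩ : A ⊆ edgesIn G U ∧ componentIn A U v = B := by simpa using hA
      simp only
      rw [← pow_add, ← Finset.card_union_of_disjoint, ← Finset.inter_union_distrib_left,
        Finset.inter_eq_left.mpr (subset_edgesIn_componentIn hAU v)]
      exact hd.mono Finset.inter_subset_right Finset.inter_subset_right
  · intro A _
    simp [componentIn, hv]

end Connected

/-! ### Breadth-first layers and nonnegativity -/

section Layers

variable {V : Type*} [DecidableEq V] (G : SimpleGraph V)

/-- The sum of `(X - 1) ^ |A|`, divided by `(X - 1) ^ |W|`, over the edge sets `A` of `G` which join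
every vertex of `W` to `T`, where `T` is the last layer found by a breadth-first search, `W` is the
set of vertices not reached yet, and the edges inside `T` are left out. The next layer `S` is
nonempty, each of its vertices has a neighbour in `T`, and the edges inside it are arbitrary. The
coefficients are natural numbers by construction. -/
noncomputable def layerPoly (T W : Finset V) : Polynomial ℕ :=
  if W = ∅ then 1 else
    ∑ S ∈ (W.powerset.erase ∅).attach, Polynomial.X ^ (edgesIn G S.1).card *
      (∏ s ∈ S.1, ∑ i ∈ Finset.range (degIn G T s), Polynomial.X ^ i) * layerPoly S.1 (W \ S.1)
termination_by W.card
decreasing_by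
  have h := S.2
  rw [Finset.mem_erase, Finset.mem_powerset] at h
  refine Finset.card_lt_card (Finset.sdiff_ssubset h.2 (Finset.nonempty_iff_ne_empty.mpr h.1))

variable {R : Type*} [CommRing R] (y : R)

/-- The value at `y` of the sum of `(X - 1) ^ |A|` of which `layerPoly` is the quotient by
`(X - 1) ^ |W|`. -/
noncomputable def layerWeight (T W : Finset V) : R :=
  (y - 1) ^ W.card * Polynomial.aeval y (layerPoly G T W)

theorem layerWeight_empty (T : Finset V) : layerWeight G y T ∅ = 1 := by
  rw [layerWeight, layerPoly]; simp

theorem layerWeight_eq (T : Finset V) {W : Finset V} (hW : W ≠ ∅) : layerWeight G y T W =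
    ∑ S ∈ W.powerset.erase ∅, y ^ (edgesIn G S).card * (∏ s ∈ S, (y ^ degIn G T s - 1)) *
      layerWeight G y S (W \ S) := by
  rw [layerWeight, layerPoly, if_neg hW, map_sum, Finset.mul_sum,
    Finset.sum_attach (W.powerset.erase ∅) (fun S => (y - 1) ^ W.card * Polynomial.aeval y
      (Polynomial.X ^ (edgesIn G S).card *
        (∏ s ∈ S, ∑ i ∈ Finset.range (degIn G T s), Polynomial.X ^ i) * layerPoly G S (W \ S)))]
  refine Finset.sum_congr rfl fun S hS => ?_
  rw [Finset.mem_erase, Finset.mem_powerset] at hS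
  have hc : W.card = S.card + (W \ S).card := by
    rw [add_comm, Finset.card_sdiff_add_card_eq_card hS.2]
  simp only [← mul_geom_sum, Finset.prod_mul_distrib, Finset.prod_const, layerWeight, map_mul,
    map_prod, map_sum, map_pow, Polynomial.aeval_X, hc, pow_add]
  ring

/-- Sorting the vertices of `W` by whether `T` reaches them. -/
theorem sum_layerWeight (W : Finset V) : ∀ T : Finset V,
    y ^ ((edgesIn G W).card + ∑ w ∈ W, degIn G T w) =
      ∑ B ∈ W.powerset, layerWeight G y T B * y ^ (edgesIn G (W \ B)).card := by
  induction W using Finset.strongInduction with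
  | H W ih =>
  intro T
  have step : ∀ S ∈ W.powerset.erase ∅,
      y ^ (edgesIn G W).card * ∏ s ∈ S, (y ^ degIn G T s - 1) =
      ∑ B ∈ (W \ S).powerset, y ^ (edgesIn G S).card * (∏ s ∈ S, (y ^ degIn G T s - 1)) *
        layerWeight G y S B * y ^ (edgesIn G ((W \ S) \ B)).card := by
    intro S hS
    rw [Finset.mem_erase, Finset.mem_powerset] at hS
    have h := ih (W \ S) (Finset.sdiff_ssubset hS.2 (Finset.nonempty_iff_ne_empty.mpr hS.1)) S
    have hc := card_edgesIn_union G (S := S) (W := W \ S) Finset.disjoint_sdiff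
    rw [Finset.union_sdiff_of_subset hS.2] at hc
    rw [hc, add_assoc, pow_add, h, Finset.mul_sum, Finset.sum_mul]
    exact Finset.sum_congr rfl fun B _ => by ring
  have expand : y ^ (∑ w ∈ W, degIn G T w) =
      ∑ S ∈ W.powerset, ∏ s ∈ S, (y ^ degIn G T s - 1) := by
    rw [← Finset.prod_add_one, ← Finset.prod_pow_eq_pow_sum]
    simp
  rw [pow_add, expand, ← Finset.add_sum_erase _ _ (Finset.empty_mem_powerset W),
    ← Finset.add_sum_erase W.powerset (fun B => layerWeight G y T B * _)
      (Finset.empty_mem_powerset W), layerWeight_empty]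
  simp only [Finset.prod_empty, mul_add, mul_one, one_mul, Finset.sdiff_empty, Finset.mul_sum]
  congr 1
  rw [Finset.sum_congr rfl step]
  have e : ∀ B ∈ W.powerset.erase ∅, layerWeight G y T B * y ^ (edgesIn G (W \ B)).card =
      ∑ S ∈ B.powerset.erase ∅, y ^ (edgesIn G S).card * (∏ s ∈ S, (y ^ degIn G T s - 1)) *
        layerWeight G y S (B \ S) * y ^ (edgesIn G (W \ B)).card := by
    intro B hB
    rw [layerWeight_eq G y T (Finset.ne_of_mem_erase hB), Finset.sum_mul]
  rw [Finset.sum_congr rfl e, Finset.sum_sigma', Finset.sum_sigma']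
  refine Finset.sum_bij' (fun p _ => ⟨p.1 ∪ p.2, p.1⟩) (fun p _ => ⟨p.2, p.1 \ p.2⟩) ?_ ?_ ?_ ?_ ?_
  · rintro ⟨S, B⟩ h
    simp only [Finset.mem_sigma, Finset.mem_erase, Finset.mem_powerset] at h ⊢
    obtain ⟨⟨h1, h2⟩, h3⟩ := h
    refine ⟨⟨?_, Finset.union_subset h2 (h3.trans Finset.sdiff_subset)⟩, h1,
      Finset.subset_union_left⟩
    simp [Finset.union_eq_empty, h1]
  · rintro ⟨B, S⟩ h
    simp only [Finset.mem_sigma, Finset.mem_erase, Finset.mem_powerset] at h ⊢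
    exact ⟨⟨h.2.1, h.2.2.trans h.1.2⟩, Finset.sdiff_subset_sdiff h.1.2 subset_rfl⟩
  · rintro ⟨S, B⟩ h
    simp only [Finset.mem_sigma, Finset.mem_erase, Finset.mem_powerset] at h
    have : Disjoint S B := Finset.disjoint_of_subset_right h.2 Finset.disjoint_sdiff
    simp [Finset.union_sdiff_cancel_left this]
  · rintro ⟨B, S⟩ h
    simp only [Finset.mem_sigma, Finset.mem_erase, Finset.mem_powerset] at h
    simp [Finset.union_sdiff_of_subset h.2.2]
  · rintro ⟨S, B⟩ h
    simp only [Finset.mem_sigma, Finset.mem_erase, Finset.mem_powerset] at h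
    have : Disjoint S B := Finset.disjoint_of_subset_right h.2 Finset.disjoint_sdiff
    simp only [Finset.union_sdiff_cancel_left this, sdiff_sdiff_left, Finset.sup_eq_union]

theorem connWeight_eq_layerWeight (U : Finset V) {v : V} (hv : v ∈ U) :
    connWeight G y U = layerWeight G y {v} (U.erase v) := by
  induction U using Finset.strongInduction with
  | H U ih =>
  have h1 := pow_card_edgesIn G y hv
  have h2 := sum_layerWeight G y (U.erase v) {v}
  have hd := card_edgesIn_union G (S := {v}) (W := U.erase v) (by simp)
  rw [← Finset.insert_eq, Finset.insert_erase hv] at hd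
  have h0 : (edgesIn G {v}).card = 0 := by
    rw [Finset.card_eq_zero, Finset.eq_empty_iff_forall_notMem]
    intro e
    induction e with | _ a b
    rw [mk_mem_edgesIn, Finset.mem_singleton, Finset.mem_singleton]
    rintro ⟨rfl, rfl, h⟩
    exact h.ne rfl
  rw [h0, zero_add] at hd
  rw [← hd, h1] at h2
  have h3 : ∑ B ∈ (U.erase v).powerset,
      layerWeight G y {v} B * y ^ (edgesIn G (U.erase v \ B)).card =
      ∑ B ∈ U.powerset with v ∈ B,
        layerWeight G y {v} (B.erase v) * y ^ (edgesIn G (U \ B)).card := by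
    refine Finset.sum_bij' (fun B _ => insert v B) (fun B _ => B.erase v) ?_ ?_ ?_ ?_ ?_
    · intro B hB
      rw [Finset.mem_powerset, Finset.subset_erase] at hB
      simp [Finset.insert_subset_iff, hv, hB.1]
    · intro B hB
      simp only [Finset.mem_filter, Finset.mem_powerset] at hB ⊢
      exact Finset.erase_subset_erase v hB.1
    · intro B hB
      rw [Finset.mem_powerset, Finset.subset_erase] at hB
      exact Finset.erase_insert hB.2
    · intro B hB
      exact Finset.insert_erase (Finset.mem_filter.mp hB).2
    · intro B hB
      rw [Finset.mem_powerset, Finset.subset_erase] at hB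
      have : U.erase v \ B = U \ insert v B := by
        ext x
        simp only [Finset.mem_sdiff, Finset.mem_erase, Finset.mem_insert]
        tauto
      rw [Finset.erase_insert hB.2, this]
  rw [h3] at h2
  have hU : U ∈ U.powerset.filter (v ∈ ·) := by simp [hv]
  rw [← Finset.add_sum_erase _ _ hU, ← Finset.add_sum_erase _ _ hU] at h2
  have h4 : ∀ B ∈ (U.powerset.filter (v ∈ ·)).erase U,
      connWeight G y B * y ^ (edgesIn G (U \ B)).card =
      layerWeight G y {v} (B.erase v) * y ^ (edgesIn G (U \ B)).card := by
    intro B hB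
    simp only [Finset.mem_erase, Finset.mem_filter, Finset.mem_powerset] at hB
    rw [ih B (Finset.ssubset_iff_subset_ne.mpr ⟨hB.2.1, hB.1⟩) hB.2.2]
  rw [Finset.sum_congr rfl h4, add_left_inj] at h2
  simpa [edgesIn] using h2

/-- The generating function of the connected graphs on a nonempty vertex set `U` is
`(y - 1) ^ (|U| - 1)` times a polynomial with coefficients in `ℕ`. -/
theorem exists_connWeight_eq {U : Finset V} (hU : U.Nonempty) : ∃ P : Polynomial ℕ,
    ∀ (R : Type*) [CommRing R] (y : R),
      connWeight G y U = (y - 1) ^ (U.card - 1) * Polynomial.aeval y P := by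
  obtain ⟨v, hv⟩ := hU
  refine ⟨layerPoly G {v} (U.erase v), fun R _ y => ?_⟩
  rw [connWeight_eq_layerWeight G y U hv, layerWeight, Finset.card_erase_of_mem hv]

end Layers

/-! ### Matchings of finite sets of natural numbers and the moments -/

section FinsetMatchings

/-- The crossing relation as a graph on all finite sets of natural numbers. -/
def crossGraph : SimpleGraph (Finset ℕ) where
  Adj a b := Crosses a b ∨ Crosses b a
  symm := ⟨fun _ _ h => h.symm⟩
  loopless := ⟨by
    intro a h
    obtain ⟨i, j, k, l, h1, h2, h3, h4, h5⟩ : Crosses a a := h.elim id id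
    have : i ∈ ({k, l} : Finset ℕ) := by rw [← h2, h1]; simp
    simp only [Finset.mem_insert, Finset.mem_singleton] at this
    omega⟩

/-- A matching of an arbitrary finite set `U` of natural numbers, as the set of its arches. Unlike
`Finpartition U`, this does not make the type of a matching depend on `U`. -/
structure IsMatchingOf (U : Finset ℕ) (σ : Finset (Finset ℕ)) : Prop where
  card_eq : ∀ b ∈ σ, b.card = 2
  disjoint : (σ : Set (Finset ℕ)).PairwiseDisjoint id
  biUnion_eq : σ.biUnion id = U

namespace IsMatchingOf

variable {U : Finset ℕ} {σ : Finset (Finset ℕ)}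

theorem subset (h : IsMatchingOf U σ) {b : Finset ℕ} (hb : b ∈ σ) : b ⊆ U := by
  rw [← h.biUnion_eq]
  exact Finset.subset_biUnion_of_mem id hb

theorem exists_mem (h : IsMatchingOf U σ) {x : ℕ} (hx : x ∈ U) : ∃ b ∈ σ, x ∈ b := by
  rw [← h.biUnion_eq] at hx
  simpa using hx

theorem eq_of_mem (h : IsMatchingOf U σ) {b c : Finset ℕ} (hb : b ∈ σ) (hc : c ∈ σ) {x : ℕ}
    (hxb : x ∈ b) (hxc : x ∈ c) : b = c :=
  h.disjoint.elim_finset hb hc x hxb hxc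

theorem of_subset (h : IsMatchingOf U σ) {τ : Finset (Finset ℕ)} (hτ : τ ⊆ σ) :
    IsMatchingOf (τ.biUnion id) τ :=
  ⟨fun b hb => h.card_eq b (hτ hb), h.disjoint.subset (by exact_mod_cast hτ), rfl⟩

theorem biUnion_sdiff (h : IsMatchingOf U σ) {τ : Finset (Finset ℕ)} (hτ : τ ⊆ σ) :
    (σ \ τ).biUnion id = U \ τ.biUnion id := by
  ext x
  simp only [Finset.mem_biUnion, Finset.mem_sdiff, id]
  constructor
  · rintro ⟨b, ⟨hb, hb'⟩, hx⟩
    exact ⟨h.subset hb hx, fun ⟨c, hc, hxc⟩ => hb' (h.eq_of_mem hb (hτ hc) hx hxc ▸ hc)⟩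
  · rintro ⟨hx, hx'⟩
    obtain ⟨b, hb, hxb⟩ := h.exists_mem hx
    exact ⟨b, ⟨hb, fun hb' => hx' ⟨b, hb', hxb⟩⟩, hxb⟩

theorem union {W : Finset ℕ} {τ : Finset (Finset ℕ)} (h : IsMatchingOf U σ)
    (h' : IsMatchingOf W τ) (hd : Disjoint U W) : IsMatchingOf (U ∪ W) (σ ∪ τ) := by
  refine ⟨fun b hb => (Finset.mem_union.mp hb).elim (h.card_eq b) (h'.card_eq b), ?_, ?_⟩
  · rw [Finset.coe_union, Set.pairwiseDisjoint_union]
    exact ⟨h.disjoint, h'.disjoint, fun a ha b hb _ => hd.mono (h.subset ha) (h'.subset hb)⟩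
  · rw [Finset.union_biUnion, h.biUnion_eq, h'.biUnion_eq]

theorem disjoint_of_disjoint {W : Finset ℕ} {τ : Finset (Finset ℕ)} (h : IsMatchingOf U σ)
    (h' : IsMatchingOf W τ) (hd : Disjoint U W) : Disjoint σ τ := by
  rw [Finset.disjoint_left]
  intro b hb hb'
  obtain ⟨x, hx⟩ : b.Nonempty := Finset.card_pos.mp (by rw [h.card_eq b hb]; norm_num)
  exact Finset.disjoint_left.mp hd (h.subset hb hx) (h'.subset hb' hx)

end IsMatchingOf

open Classical in
/-- The finite set of matchings of `U`. -/
noncomputable def matchings (U : Finset ℕ) : Finset (Finset (Finset ℕ)) :=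
  U.powerset.powerset.filter (IsMatchingOf U)

theorem mem_matchings {U : Finset ℕ} {σ : Finset (Finset ℕ)} :
    σ ∈ matchings U ↔ IsMatchingOf U σ := by
  simp only [matchings, Finset.mem_filter, Finset.mem_powerset, and_iff_right_iff_imp]
  exact fun h b hb => Finset.mem_powerset.mpr (h.subset hb)

open Classical in
/-- The matchings of `P ∪ Q` without arch inside `P`. For `P` to the left of `Q`, these are the ways
to complete the pending arches opened at the points of `P`. -/
noncomputable def completions (P Q : Finset ℕ) : Finset (Finset (Finset ℕ)) :=
  (matchings (P ∪ Q)).filter fun σ => ∀ b ∈ σ, ¬ b ⊆ P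

theorem mem_completions {P Q : Finset ℕ} {σ : Finset (Finset ℕ)} :
    σ ∈ completions P Q ↔ IsMatchingOf (P ∪ Q) σ ∧ ∀ b ∈ σ, ¬ b ⊆ P := by
  simp [completions, mem_matchings]

theorem completions_empty_left (U : Finset ℕ) : completions ∅ U = matchings U := by
  ext σ
  rw [mem_completions, mem_matchings, Finset.empty_union, and_iff_left_iff_imp]
  intro h b hb hb'
  have := h.card_eq b hb
  rw [Finset.subset_empty.mp hb'] at this
  simp at this

theorem completions_empty_right (P : Finset ℕ) :
    completions P ∅ = if P = ∅ then {∅} else ∅ := by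
  ext σ
  rw [mem_completions, Finset.union_empty]
  split_ifs with hP
  · subst hP
    rw [Finset.mem_singleton]
    constructor
    · rintro ⟨h, h'⟩
      exact Finset.eq_empty_of_forall_notMem fun b hb => h' b hb (h.subset hb)
    · rintro rfl
      exact ⟨⟨by simp, by simp, by simp⟩, by simp⟩
  · simp only [Finset.notMem_empty, iff_false, not_and, not_forall, not_not]
    intro h
    obtain ⟨x, hx⟩ := Finset.nonempty_iff_ne_empty.mpr hP
    obtain ⟨b, hb, _⟩ := h.exists_mem hx
    exact ⟨b, hb, h.subset hb⟩

variable {P Q : Finset ℕ} {x p : ℕ}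

/-- In a completion, an arch through a point of `P` has its other end in `Q`. -/
theorem inter_eq_singleton_of_mem_completions {σ : Finset (Finset ℕ)} (hσ : σ ∈ completions P Q)
    {b : Finset ℕ} (hb : b ∈ σ) (hp : p ∈ P) (hpb : p ∈ b) : b ∩ P = {p} := by
  rw [mem_completions] at hσ
  refine Finset.eq_singleton_iff_unique_mem.mpr ⟨Finset.mem_inter.mpr ⟨hpb, hp⟩, fun z hz => ?_⟩
  by_contra hne
  refine hσ.2 b hb ?_
  rw [Finset.mem_inter] at hz
  have : {p, z} = b := Finset.eq_of_subset_of_card_le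
    (by simp [Finset.insert_subset_iff, hpb, hz.1])
    (by rw [hσ.1.card_eq b hb, Finset.card_pair (Ne.symm hne)])
  rw [← this]
  simp [Finset.insert_subset_iff, hp, hz.2]

/-- The completions in which `x` opens an arch are those for which `x` is one more pending
point. -/
theorem filter_completions_open (hx : x ∈ Q) :
    (completions P Q).filter (fun σ => ∀ b ∈ σ, ¬ b ⊆ insert x P) =
      completions (insert x P) (Q.erase x) := by
  have hU : insert x P ∪ Q.erase x = P ∪ Q := by
    ext z
    by_cases hz : z = x
    · simp [hz, hx]
    · simp [hz]
  ext σ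
  rw [Finset.mem_filter, mem_completions, mem_completions, hU, and_assoc]
  refine and_congr_right fun _ => and_iff_right_of_imp fun h b hb hbP => h b hb ?_
  exact hbP.trans (Finset.subset_insert x P)

/-- If `x` does not open an arch, it closes one opened in `P`. -/
theorem filter_completions_close :
    (completions P Q).filter (fun σ => ¬ ∀ b ∈ σ, ¬ b ⊆ insert x P) =
      P.biUnion fun p => (completions P Q).filter ({p, x} ∈ ·) := by
  ext σ
  simp only [Finset.mem_filter, Finset.mem_biUnion, not_forall, not_not]
  constructor
  · rintro ⟨hσ, b, hb, hbx⟩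
    have h := mem_completions.mp hσ
    have hxb : x ∈ b := by
      by_contra hxb
      exact h.2 b hb ((Finset.subset_insert_iff_of_notMem hxb).mp hbx)
    obtain ⟨p, hp⟩ := Finset.card_eq_one.mp
      (show (b.erase x).card = 1 by rw [Finset.card_erase_of_mem hxb, h.1.card_eq b hb])
    have hb' : b = {p, x} := by rw [← Finset.insert_erase hxb, hp, Finset.pair_comm]
    have hpx : p ∈ b.erase x := by simp [hp]
    rw [Finset.mem_erase] at hpx
    have hpP : p ∈ P := (Finset.mem_insert.mp (hbx hpx.2)).resolve_left hpx.1
    exact ⟨p, hpP, hσ, hb' ▸ hb⟩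
  · rintro ⟨p, hp, hσ, hb⟩
    refine ⟨hσ, _, hb, ?_⟩
    simp [Finset.insert_subset_iff, hp]

/-- The arches crossing the arch from `p` to the first point `x` of `Q` are those opened in `P`
after `p`. -/
theorem degIn_closing_arch (hlt : ∀ p ∈ P, p < x) (hQ : ∀ z ∈ Q, x ≤ z) (hx : x ∈ Q) (hp : p ∈ P)
    {σ : Finset (Finset ℕ)} (hσ : σ ∈ completions P Q) (hb : {p, x} ∈ σ) :
    degIn crossGraph (σ.erase {p, x}) {p, x} = (P.filter (p < ·)).card := by
  classical
  have h := mem_completions.mp hσ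
  -- An arch of `σ` through a point `k` of `P` after `p` ends to the right of `x`.
  have key : ∀ b ∈ σ, ∀ k ∈ P, p < k → k ∈ b → ∃ l, b = {k, l} ∧ x < l := by
    intro b hbσ k hk hpk hkb
    have hbx : b ≠ {p, x} := by
      rintro rfl
      have := hlt k hk
      simp only [Finset.mem_insert, Finset.mem_singleton] at hkb
      omega
    obtain ⟨l, hl⟩ := Finset.card_eq_one.mp
      (show (b.erase k).card = 1 by rw [Finset.card_erase_of_mem hkb, h.1.card_eq b hbσ])
    have hb' : b = {k, l} := by rw [← Finset.insert_erase hkb, hl]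
    have hlb : l ∈ b := by simp [hb']
    have hlP : l ∉ P := by
      intro hlP
      exact h.2 b hbσ (by simp [hb', Finset.insert_subset_iff, hk, hlP])
    have hlx : l ≠ x := by
      rintro rfl
      exact hbx (h.1.eq_of_mem hbσ hb hlb (by simp))
    have hlQ := hQ l ((Finset.mem_union.mp (h.1.subset hbσ hlb)).resolve_left hlP)
    exact ⟨l, hb', by omega⟩
  have hP : ∀ b ∈ σ, ∀ k ∈ b, k < x → k ∈ P := by
    intro b hbσ k hk hkx
    refine (Finset.mem_union.mp (h.1.subset hbσ hk)).resolve_right fun hkQ => ?_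
    have := hQ k hkQ
    omega
  have hpx := hlt p hp
  have hcross : ∀ b ∈ σ, crossGraph.Adj {p, x} b → ∃ k ∈ P, p < k ∧ k ∈ b := by
    rintro b hbσ (⟨i, j, k, l, h1, rfl, h3, h4, h5⟩ | ⟨i, j, k, l, rfl, h2, h3, h4, h5⟩)
    · have hi : i ∈ ({p, x} : Finset ℕ) := by simp [h1]
      have hj : j ∈ ({p, x} : Finset ℕ) := by simp [h1]
      simp only [Finset.mem_insert, Finset.mem_singleton] at hi hj
      exact ⟨k, hP _ hbσ k (by simp) (by omega), by omega, by simp⟩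
    · have hk : k ∈ ({p, x} : Finset ℕ) := by simp [h2]
      have hl : l ∈ ({p, x} : Finset ℕ) := by simp [h2]
      simp only [Finset.mem_insert, Finset.mem_singleton] at hk hl
      exact ⟨j, hP _ hbσ j (by simp) (by omega), by omega, by simp⟩
  refine Finset.card_nbij (fun b => ∑ k ∈ b ∩ P, k) ?_ ?_ ?_
  · intro b hbσ
    rw [Finset.mem_coe, Finset.mem_filter, Finset.mem_erase] at hbσ
    obtain ⟨k, hk, hpk, hkb⟩ := hcross b hbσ.1.2 hbσ.2
    simp [inter_eq_singleton_of_mem_completions hσ hbσ.1.2 hk hkb, hk, hpk]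
  · intro b hbσ c hcσ hbc
    rw [Finset.mem_coe, Finset.mem_filter, Finset.mem_erase] at hbσ hcσ
    obtain ⟨k, hk, hpk, hkb⟩ := hcross b hbσ.1.2 hbσ.2
    obtain ⟨k', hk', hpk', hkc⟩ := hcross c hcσ.1.2 hcσ.2
    simp only [inter_eq_singleton_of_mem_completions hσ hbσ.1.2 hk hkb,
      inter_eq_singleton_of_mem_completions hσ hcσ.1.2 hk' hkc, Finset.sum_singleton] at hbc
    subst hbc
    exact h.1.eq_of_mem hbσ.1.2 hcσ.1.2 hkb hkc
  · intro k hk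
    rw [Finset.mem_coe, Finset.mem_filter] at hk
    obtain ⟨b, hbσ, hkb⟩ := h.1.exists_mem (Finset.mem_union_left Q hk.1)
    obtain ⟨l, rfl, hl⟩ := key b hbσ k hk.1 hk.2 hkb
    refine ⟨{k, l}, ?_, ?_⟩
    · rw [Finset.mem_coe, Finset.mem_filter, Finset.mem_erase]
      refine ⟨⟨?_, hbσ⟩, Or.inl ⟨p, x, k, l, rfl, rfl, hk.2, hlt k hk.1, hl⟩⟩
      intro e
      have : k ∈ ({p, x} : Finset ℕ) := by rw [← e]; simp
      have := hlt k hk.1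
      simp only [Finset.mem_insert, Finset.mem_singleton] at *
      omega
    · simp [inter_eq_singleton_of_mem_completions hσ hbσ hk.1 hkb]

variable {R : Type*} [CommRing R] (q : R)

/-- Removing the arch from `p` to `x` loses its crossings and leaves a completion of the other
pending arches. -/
theorem sum_completions_close (hlt : ∀ p ∈ P, p < x) (hQ : ∀ z ∈ Q, x ≤ z) (hx : x ∈ Q)
    (hp : p ∈ P) :
    ∑ σ ∈ completions P Q with {p, x} ∈ σ, q ^ (edgesIn crossGraph σ).card =
      q ^ (P.filter (p < ·)).card *
        ∑ σ ∈ completions (P.erase p) (Q.erase x), q ^ (edgesIn crossGraph σ).card := by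
  have hpx := hlt p hp
  have hxP : x ∉ P := fun h => lt_irrefl x (hlt x h)
  have hpQ : p ∉ Q := fun h => absurd (hQ p h) (by omega)
  have hU : (P ∪ Q) \ {p, x} = P.erase p ∪ Q.erase x := by
    ext z
    simp only [Finset.mem_sdiff, Finset.mem_union, Finset.mem_insert, Finset.mem_singleton,
      Finset.mem_erase]
    constructor
    · tauto
    · rintro (⟨h1, h2⟩ | ⟨h1, h2⟩)
      · exact ⟨Or.inl h2, by rintro (h | h) <;> simp_all⟩
      · exact ⟨Or.inr h2, by rintro (h | h) <;> simp_all⟩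
  have hsub : ({p, x} : Finset ℕ) ⊆ P ∪ Q := by simp [Finset.insert_subset_iff, hp, hx]
  have hpair : IsMatchingOf {p, x} {{p, x}} :=
    ⟨by simpa using Finset.card_pair hpx.ne, by simp, by simp⟩
  rw [Finset.mul_sum]
  refine Finset.sum_bij' (fun σ _ => σ.erase {p, x}) (fun σ _ => insert {p, x} σ) ?_ ?_ ?_ ?_ ?_
  · intro σ hσ
    rw [Finset.mem_filter, mem_completions] at hσ
    obtain ⟨⟨h, h'⟩, hb⟩ := hσ
    rw [mem_completions, ← hU]
    refine ⟨?_, fun b hb hbP => h' b (Finset.mem_of_mem_erase hb)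
      (hbP.trans (Finset.erase_subset p P))⟩
    have h1 := h.of_subset (Finset.erase_subset {p, x} σ)
    rwa [Finset.erase_eq, h.biUnion_sdiff (by simpa using hb), Finset.singleton_biUnion,
      ← Finset.erase_eq] at h1
  · intro σ hσ
    rw [mem_completions, ← hU] at hσ
    have h1 := hpair.union hσ.1 Finset.disjoint_sdiff
    rw [Finset.union_sdiff_of_subset hsub, ← Finset.insert_eq] at h1
    rw [Finset.mem_filter, mem_completions]
    refine ⟨⟨h1, fun b hb hbP => ?_⟩, Finset.mem_insert_self _ _⟩
    rcases Finset.mem_insert.mp hb with rfl | hb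
    · exact hxP (hbP (by simp))
    · refine hσ.2 b hb fun z hz => Finset.mem_erase.mpr ⟨?_, hbP hz⟩
      have := hσ.1.subset hb hz
      simp only [Finset.mem_sdiff, Finset.mem_insert, not_or] at this
      exact this.2.1
  · intro σ hσ
    exact Finset.insert_erase (Finset.mem_filter.mp hσ).2
  · intro σ hσ
    rw [mem_completions, ← hU] at hσ
    refine Finset.erase_insert fun hb => ?_
    exact (Finset.mem_sdiff.mp (hσ.1.subset hb (Finset.mem_insert_self p _))).2 (by simp)
  · intro σ hσ
    rw [Finset.mem_filter] at hσ
    rw [← degIn_closing_arch hlt hQ hx hp hσ.1 hσ.2, ← pow_add, add_comm,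
      ← card_edgesIn_insert crossGraph (Finset.notMem_erase _ _), Finset.insert_erase hσ.2]

theorem sum_pow_card_filter_lt (P : Finset ℕ) :
    ∑ p ∈ P, q ^ (P.filter (p < ·)).card = ∑ i ∈ Finset.range P.card, q ^ i := by
  induction P using Finset.induction_on_min with
  | empty => simp
  | insert a s has ih =>
    have ha : a ∉ s := fun h => lt_irrefl a (has a h)
    rw [Finset.sum_insert ha, Finset.card_insert_of_notMem ha, Finset.sum_range_succ, add_comm,
      ← ih]
    congr 1
    · refine Finset.sum_congr rfl fun p hp => ?_
      rw [Finset.filter_insert, if_neg (by have := has p hp; omega)]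
    · rw [Finset.filter_insert, if_neg (lt_irrefl a), Finset.filter_true_of_mem has]

/-- Reading the points of `Q` from left to right turns completions into weighted lattice paths, the
height being the number of pending arches: a point closing the `i`th newest pending arch creates
`i - 1` crossings. -/
theorem sum_completions {K : Type*} [Field K] {q : K} (hq : q ≠ 1) (n : ℕ) : ∀ P Q : Finset ℕ,
    Q.card = n → (∀ p ∈ P, ∀ z ∈ Q, p < z) →
    ∑ σ ∈ completions P Q, q ^ (edgesIn crossGraph σ).card = pathSum q n P.card := by
  induction n with
  | zero =>
    intro P Q hQ _
    rw [Finset.card_eq_zero.mp hQ, completions_empty_right, pathSum_zero]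
    by_cases hP : P = ∅
    · simp [hP, edgesIn]
    · simp [hP]
  | succ n ih =>
    intro P Q hQ hlt
    have hne : Q.Nonempty := Finset.card_pos.mp (by omega)
    obtain ⟨x, hx, hmin⟩ : ∃ x ∈ Q, ∀ z ∈ Q, x ≤ z := ⟨_, Q.min'_mem hne, fun z => Q.min'_le z⟩
    have hPx : ∀ p ∈ P, p < x := fun p hp => hlt p hp x hx
    have hxP : x ∉ P := fun h => lt_irrefl x (hPx x h)
    have hcard : (Q.erase x).card = n := by rw [Finset.card_erase_of_mem hx]; omega
    have hQx : ∀ z ∈ Q.erase x, x < z := fun z hz =>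
      lt_of_le_of_ne (hmin z (Finset.mem_of_mem_erase hz)) (Finset.ne_of_mem_erase hz).symm
    rw [← Finset.sum_filter_add_sum_filter_not _ (fun σ => ∀ b ∈ σ, ¬ b ⊆ insert x P),
      filter_completions_open hx, filter_completions_close, Finset.sum_biUnion, pathSum_succ,
      ih _ _ hcard, Finset.card_insert_of_notMem hxP]
    · congr 1
      rw [qInt_eq_sum hq, ← sum_pow_card_filter_lt, Finset.sum_mul]
      refine Finset.sum_congr rfl fun p hp => ?_
      rw [sum_completions_close q hPx hmin hx hp, ih _ _ hcard, Finset.card_erase_of_mem hp]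
      exact fun a ha z hz => (hPx a (Finset.mem_of_mem_erase ha)).trans (hQx z hz)
    · intro p hp z hz
      rcases Finset.mem_insert.mp hp with rfl | hp
      · exact hQx z hz
      · exact hlt p hp z (Finset.mem_of_mem_erase hz)
    · intro p hp p' hp' hne
      refine Finset.disjoint_left.mpr fun σ hσ hσ' => hne ?_
      rw [Finset.mem_filter] at hσ hσ'
      have e := (mem_completions.mp hσ.1).1.eq_of_mem hσ.2 hσ'.2 (x := x) (by simp) (by simp)
      have : p ∈ ({p', x} : Finset ℕ) := by rw [← e]; simp
      have := hPx p hp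
      simp only [Finset.mem_insert, Finset.mem_singleton] at *
      omega

/-- The moments of the `q`-semicircular law count matchings by crossings. -/
theorem sum_matchings {K : Type*} [Field K] {q : K} (hq : q ≠ 1) (U : Finset ℕ) :
    ∑ σ ∈ matchings U, q ^ (edgesIn crossGraph σ).card = moment q U.card := by
  rw [← completions_empty_left, sum_completions hq U.card ∅ U rfl (by simp), moment_eq_pathSum,
    Finset.card_empty]

end FinsetMatchings

/-! ### Cumulants as sums over connected subgraphs of crossing graphs -/

section CumulantFormula

/-- The sum, over the matchings `σ` of `U`, of the generating functions of the connected graphs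
formed by crossings of `σ`. -/
noncomputable def matchingConnWeight {R : Type*} [CommRing R] (q : R) (U : Finset ℕ) : R :=
  ∑ σ ∈ matchings U, connWeight crossGraph q σ

/-- The crossing-weighted matchings of `U` are obtained by choosing the set `S` of the points
of the component of a fixed point `u`. -/
theorem sum_matchings_eq_sum_component {R : Type*} [CommRing R] (q : R) {U : Finset ℕ} {u : ℕ}
    (hu : u ∈ U) :
    ∑ σ ∈ matchings U, q ^ (edgesIn crossGraph σ).card =
      ∑ S ∈ U.powerset with u ∈ S, matchingConnWeight q S *
        ∑ σ ∈ matchings (U \ S), q ^ (edgesIn crossGraph σ).card := by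
  have step : ∀ σ ∈ matchings U, q ^ (edgesIn crossGraph σ).card =
      ∑ B ∈ σ.powerset with u ∈ B.biUnion id,
        connWeight crossGraph q B * q ^ (edgesIn crossGraph (σ \ B)).card := by
    intro σ hσ
    rw [mem_matchings] at hσ
    obtain ⟨b, hb, hub⟩ := hσ.exists_mem hu
    rw [pow_card_edgesIn crossGraph q hb]
    refine Finset.sum_congr (Finset.filter_congr fun B hB => ?_) fun _ _ => rfl
    rw [Finset.mem_powerset] at hB
    simp only [Finset.mem_biUnion, id]
    exact ⟨fun h => ⟨b, h, hub⟩, fun ⟨c, hc, huc⟩ => hσ.eq_of_mem hb (hB hc) hub huc ▸ hc⟩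
  rw [Finset.sum_congr rfl step, Finset.sum_sigma']
  simp only [matchingConnWeight, Finset.sum_mul_sum, ← Finset.sum_product']
  rw [Finset.sum_sigma']
  refine Finset.sum_bij' (fun p _ => ⟨p.2.biUnion id, p.2, p.1 \ p.2⟩)
    (fun p _ => ⟨p.2.1 ∪ p.2.2, p.2.1⟩) ?_ ?_ ?_ ?_ ?_
  · rintro ⟨σ, B⟩ h
    simp only [Finset.mem_sigma, Finset.mem_filter, Finset.mem_powerset, mem_matchings,
      Finset.mem_product] at h ⊢
    obtain ⟨hσ, hB, huB⟩ := h
    refine ⟨⟨?_, huB⟩, hσ.of_subset hB, hσ.biUnion_sdiff hB ▸ hσ.of_subset Finset.sdiff_subset⟩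
    rw [← hσ.biUnion_eq]
    exact Finset.biUnion_subset_biUnion_of_subset_left id hB
  · rintro ⟨S, σ, τ⟩ h
    simp only [Finset.mem_sigma, Finset.mem_filter, Finset.mem_powerset, mem_matchings,
      Finset.mem_product] at h ⊢
    obtain ⟨⟨hS, huS⟩, hσ, hτ⟩ := h
    refine ⟨?_, Finset.subset_union_left, by rwa [hσ.biUnion_eq]⟩
    have := hσ.union hτ Finset.disjoint_sdiff
    rwa [Finset.union_sdiff_of_subset hS] at this
  · rintro ⟨σ, B⟩ h
    simp only [Finset.mem_sigma, Finset.mem_filter, Finset.mem_powerset] at h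
    simp [Finset.union_sdiff_of_subset h.2.1]
  · rintro ⟨S, σ, τ⟩ h
    simp only [Finset.mem_sigma, Finset.mem_filter, Finset.mem_powerset, mem_matchings,
      Finset.mem_product] at h
    obtain ⟨⟨hS, huS⟩, hσ, hτ⟩ := h
    simp only [hσ.biUnion_eq, Finset.union_sdiff_cancel_left
      (hσ.disjoint_of_disjoint hτ Finset.disjoint_sdiff)]
  · rintro ⟨σ, B⟩ h
    rfl

variable {K : Type*} [Field K] [CharZero K] {q : K}

/-- The moment-cumulant formula, with the block of a fixed element `u` singled out. -/
theorem moment_card_eq (q : K) {U : Finset ℕ} {u : ℕ} (hu : u ∈ U) : moment q U.card =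
    ∑ S ∈ U.powerset with u ∈ S, cumulant q S.card * moment q (U \ S).card := by
  have hU : U.card = (U.erase u).card + 1 := (Finset.card_erase_add_one hu).symm
  have h := Finset.sum_powerset_apply_card (x := U.erase u)
    (fun j => cumulant q (j + 1) * moment q ((U.erase u).card - j))
  rw [hU, moment_succ]
  simp only [nsmul_eq_mul, ← mul_assoc] at h
  rw [← h]
  refine Finset.sum_bij' (fun B _ => insert u B) (fun B _ => B.erase u) ?_ ?_ ?_ ?_ ?_
  · intro B hB
    rw [Finset.mem_powerset, Finset.subset_erase] at hB
    simp [Finset.insert_subset_iff, hu, hB.1]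
  · intro B hB
    simp only [Finset.mem_filter, Finset.mem_powerset] at hB ⊢
    exact Finset.erase_subset_erase u hB.1
  · intro B hB
    rw [Finset.mem_powerset, Finset.subset_erase] at hB
    exact Finset.erase_insert hB.2
  · intro B hB
    exact Finset.insert_erase (Finset.mem_filter.mp hB).2
  · intro B hB
    rw [Finset.mem_powerset, Finset.subset_erase] at hB
    rw [Finset.card_sdiff_of_subset (Finset.insert_subset hu hB.1),
      Finset.card_insert_of_notMem hB.2, hU, Nat.add_sub_add_right]

/-- The cumulants count the pairs of a matching and a connected spanning subgraph of its crossing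
graph. -/
theorem matchingConnWeight_eq_cumulant (hq : q ≠ 1) (U : Finset ℕ) (hU : U.Nonempty) :
    matchingConnWeight q U = cumulant q U.card := by
  induction U using Finset.strongInduction with
  | H U ih =>
  obtain ⟨u, hu⟩ := hU
  have h1 := sum_matchings_eq_sum_component q hu
  simp only [sum_matchings hq] at h1
  rw [moment_card_eq q hu] at h1
  have hmem : U ∈ U.powerset.filter (u ∈ ·) := by simp [hu]
  rw [← Finset.add_sum_erase _ _ hmem, ← Finset.add_sum_erase _ _ hmem] at h1
  have h2 : ∀ S ∈ (U.powerset.filter (u ∈ ·)).erase U,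
      cumulant q S.card * moment q (U \ S).card =
      matchingConnWeight q S * moment q (U \ S).card := by
    intro S hS
    simp only [Finset.mem_erase, Finset.mem_filter, Finset.mem_powerset] at hS
    rw [ih S (Finset.ssubset_iff_subset_ne.mpr ⟨hS.2.1, hS.1⟩) ⟨u, hS.2.2⟩]
  rw [Finset.sum_congr rfl h2, add_left_inj] at h1
  simpa [moment_zero] using h1.symm

end CumulantFormula

/-! ### Connected matchings and connected crossing graphs -/

section ConnectedMatchings

theorem isMatchingOf_parts {N : ℕ} {σ : Finpartition (Finset.Icc 1 N)} (h : IsMatching σ) :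
    IsMatchingOf (Finset.Icc 1 N) σ.parts :=
  ⟨h, σ.disjoint, σ.biUnion_parts⟩

/-- If `d` does not cross the arch `{i, j}` and has one end between `i` and `j`, then both ends of
`d` are between `i` and `j`. -/
theorem between_of_not_adj {i j : ℕ} {d : Finset ℕ} (hd : d.card = 2) (hi : i ∉ d) (hj : j ∉ d)
    (hadj : ¬ crossGraph.Adj {i, j} d) {z : ℕ} (hz : z ∈ d) (hiz : i < z) (hzj : z < j) :
    ∀ w ∈ d, i < w ∧ w < j := by
  intro w hw
  rcases eq_or_ne z w with rfl | hne
  · exact ⟨hiz, hzj⟩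
  have hdzw : d = {z, w} := (Finset.eq_of_subset_of_card_le
    (by simp [Finset.insert_subset_iff, hz, hw]) (by rw [hd, Finset.card_pair hne])).symm
  have hwi : w ≠ i := fun h => hi (h ▸ hw)
  have hwj : w ≠ j := fun h => hj (h ▸ hw)
  by_contra hcon
  rcases lt_or_gt_of_ne hwi with h | h
  · exact hadj (Or.inr ⟨w, z, i, j, by rw [hdzw, Finset.pair_comm], rfl, h, hiz, hzj⟩)
  · exact hadj (Or.inl ⟨i, j, z, w, rfl, hdzw, hiz, hzj, by omega⟩)

/-- An arch crossing `d` has an end between the ends of `d`. -/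
theorem exists_between_of_adj {i j : ℕ} {d d' : Finset ℕ} (h : crossGraph.Adj d d')
    (hd : ∀ w ∈ d, i < w ∧ w < j) : ∃ z ∈ d', i < z ∧ z < j := by
  rcases h with ⟨k, l, k', l', rfl, rfl, h1, h2, h3⟩ | ⟨k, l, k', l', rfl, rfl, h1, h2, h3⟩
  · have hk := hd k (by simp)
    have hl := hd l (by simp)
    exact ⟨k', by simp, by omega, by omega⟩
  · have hk := hd k' (by simp)
    have hl := hd l' (by simp)
    exact ⟨l, by simp, by omega, by omega⟩

variable {N : ℕ} {σ : Finpartition (Finset.Icc 1 N)}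

theorem fromEdgeSet_edgesIn_adj {τ : Finset (Finset ℕ)} {x y : Finset ℕ} :
    (SimpleGraph.fromEdgeSet (edgesIn crossGraph τ : Set (Sym2 (Finset ℕ)))).Adj x y ↔
      x ∈ τ ∧ y ∈ τ ∧ crossGraph.Adj x y := by
  rw [SimpleGraph.fromEdgeSet_adj, Finset.mem_coe, mk_mem_edgesIn]
  exact ⟨fun h => h.1, fun h => ⟨h, h.2.2.ne⟩⟩

/-- No arch inside an interval which is a union of arches crosses an arch outside of it. -/
theorem isConnected_of_joins (hσ : IsMatching σ)
    (h : Joins (edgesIn crossGraph σ.parts) σ.parts) : IsConnected σ := by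
  have hm := isMatchingOf_parts hσ
  rintro a b ha hab hb hne ⟨S, hS, hU⟩
  have hsub : Finset.Icc a b ⊆ Finset.Icc 1 N := Finset.Icc_subset_Icc ha hb
  obtain ⟨z, hz, hz'⟩ := Finset.exists_of_ssubset (Finset.ssubset_iff_subset_ne.mpr ⟨hsub, hne⟩)
  obtain ⟨c, hc, hzc⟩ := hm.exists_mem hz
  have hIcc : ∀ x, x ∈ Finset.Icc a b ↔ ∃ d ∈ S, x ∈ d := fun x => by rw [← hU]; simp
  obtain ⟨d, hd, had⟩ := (hIcc a).mp (by simp [hab])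
  refine hz' ((hIcc z).mpr ⟨c, ?_, hzc⟩)
  refine mem_of_reachable (p := (· ∈ S)) ?_ (h d (hS hd) c hc) hd
  intro x y hxy hx
  obtain ⟨-, hy, hadj⟩ := fromEdgeSet_edgesIn_adj.mp hxy
  have hx' : ∀ w ∈ x, a - 1 < w ∧ w < b + 1 := fun w hw => by
    have := Finset.mem_Icc.mp ((hIcc w).mpr ⟨x, hx, hw⟩)
    omega
  obtain ⟨w, hw, haw, hwb⟩ := exists_between_of_adj hadj hx'
  obtain ⟨e, he, hwe⟩ := (hIcc w).mp (Finset.mem_Icc.mpr ⟨by omega, by omega⟩)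
  exact hm.eq_of_mem (hS he) hy hwe hw ▸ he

/-- The interval spanned by a component of the crossing graph is a union of arches: an arch with
exactly one end in it would cross an arch of the component. -/
theorem joins_of_isConnected (hN : 1 ≤ N) (hσ : IsMatching σ) (hc : IsConnected σ) :
    Joins (edgesIn crossGraph σ.parts) σ.parts := by
  classical
  have hm := isMatchingOf_parts hσ
  set H := SimpleGraph.fromEdgeSet (edgesIn crossGraph σ.parts : Set (Sym2 (Finset ℕ)))
  obtain ⟨c₁, hc₁, h1c⟩ := hm.exists_mem (Finset.mem_Icc.mpr ⟨le_rfl, hN⟩ : 1 ∈ Finset.Icc 1 N)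
  suffices hall : ∀ c ∈ σ.parts, H.Reachable c c₁ from
    fun u hu v hv => (hall u hu).trans (hall v hv).symm
  intro c₀ hc₀
  by_contra hnot
  -- `C` is the component of `c₀`, and `[a, b]` the interval it spans.
  set C := σ.parts.filter (H.Reachable c₀)
  have hCm : ∀ d, d ∈ C ↔ d ∈ σ.parts ∧ H.Reachable c₀ d := fun d => Finset.mem_filter
  have hclosed : ∀ d ∈ C, ∀ e ∈ σ.parts, crossGraph.Adj d e → e ∈ C := by
    intro d hd e he hadj
    rw [hCm] at hd ⊢
    exact ⟨he, hd.2.trans (SimpleGraph.Adj.reachable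
      (fromEdgeSet_edgesIn_adj.mpr ⟨hd.1, he, hadj⟩))⟩
  have hWne : (C.biUnion id).Nonempty := by
    obtain ⟨x, hx⟩ : c₀.Nonempty := Finset.card_pos.mp (by rw [hσ c₀ hc₀]; norm_num)
    exact ⟨x, Finset.mem_biUnion.mpr ⟨c₀, (hCm _).mpr ⟨hc₀, SimpleGraph.Reachable.rfl⟩, hx⟩⟩
  obtain ⟨a, ha, hamin⟩ : ∃ a ∈ C.biUnion id, ∀ z ∈ C.biUnion id, a ≤ z :=
    ⟨_, Finset.min'_mem _ hWne, fun z => Finset.min'_le _ z⟩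
  obtain ⟨b, hb, hbmax⟩ : ∃ b ∈ C.biUnion id, ∀ z ∈ C.biUnion id, z ≤ b :=
    ⟨_, Finset.max'_mem _ hWne, fun z => Finset.le_max' _ z⟩
  obtain ⟨da, hda, hada⟩ : ∃ d ∈ C, a ∈ d := by simpa using ha
  obtain ⟨db, hdb, hbdb⟩ : ∃ d ∈ C, b ∈ d := by simpa using hb
  have haN := Finset.mem_Icc.mp (hm.subset ((hCm _).mp hda).1 hada)
  have hbN := Finset.mem_Icc.mp (hm.subset ((hCm _).mp hdb).1 hbdb)
  have hCI : ∀ d ∈ C, d ⊆ Finset.Icc a b := fun d hd z hz => by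
    have : z ∈ C.biUnion id := Finset.mem_biUnion.mpr ⟨d, hd, hz⟩
    exact Finset.mem_Icc.mpr ⟨hamin z this, hbmax z this⟩
  have ha1 : a ≠ 1 := by
    rintro rfl
    have := hm.eq_of_mem ((hCm _).mp hda).1 hc₁ hada h1c
    exact hnot (this ▸ ((hCm _).mp hda).2)
  refine hc a b haN.1 (hamin b hb) hbN.2 ?_
    ⟨σ.parts.filter (· ⊆ Finset.Icc a b), Finset.filter_subset _ _, ?_⟩
  · intro h
    have : 1 ∈ Finset.Icc a b := h ▸ Finset.mem_Icc.mpr ⟨le_rfl, hN⟩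
    rw [Finset.mem_Icc] at this
    omega
  -- A component meeting both sides of an arch `{i, j}` outside of it would cross this arch.
  have hsep : ∀ i j, i < j → {i, j} ∈ σ.parts → {i, j} ∉ C → ∀ d ∈ C, ∀ d' ∈ C, ∀ z ∈ d,
      ∀ w ∈ d', i < z → z < j → i < w ∧ w < j := by
    intro i j hij he heC d hd d' hd' z hz w hw hiz hzj
    have hdich : ∀ f ∈ C, ∀ z ∈ f, i < z → z < j → ∀ w ∈ f, i < w ∧ w < j := by
      intro f hf z hz hiz hzj
      have hfe : ∀ k ∈ ({i, j} : Finset ℕ), k ∉ f := fun k hk hkf =>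
        heC (hm.eq_of_mem ((hCm _).mp hf).1 he hkf hk ▸ hf)
      exact between_of_not_adj (hσ f ((hCm _).mp hf).1) (hfe i (by simp)) (hfe j (by simp))
        (fun hadj => heC (hclosed f hf _ he hadj.symm)) hz hiz hzj
    have hr : H.Reachable d d' := ((hCm _).mp hd).2.symm.trans ((hCm _).mp hd').2
    refine (mem_of_reachable (p := fun f => f ∈ C ∧ ∀ w ∈ f, i < w ∧ w < j) ?_ hr
      ⟨hd, hdich d hd z hz hiz hzj⟩).2 w hw
    rintro x y hxy ⟨hx, hxb⟩
    obtain ⟨-, hy, hadj⟩ := fromEdgeSet_edgesIn_adj.mp hxy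
    obtain ⟨t, ht, hit, htj⟩ := exists_between_of_adj hadj hxb
    have hyC := hclosed x hx y hy hadj
    exact ⟨hyC, hdich y hyC t ht hit htj⟩
  ext z
  simp only [Finset.mem_biUnion, Finset.mem_filter, id]
  refine ⟨fun ⟨d, ⟨_, hd⟩, hz⟩ => hd hz, fun hz => ?_⟩
  have hz' := Finset.mem_Icc.mp hz
  obtain ⟨e, he, hze⟩ := hm.exists_mem (x := z) (Finset.mem_Icc.mpr ⟨by omega, by omega⟩)
  refine ⟨e, ⟨he, ?_⟩, hze⟩
  by_cases heC : e ∈ C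
  · exact hCI e heC
  have hnea : ∀ t ∈ e, t ≠ a ∧ t ≠ b := by
    intro t ht
    constructor
    · rintro rfl
      exact heC (hm.eq_of_mem ((hCm _).mp hda).1 he hada ht ▸ hda)
    · rintro rfl
      exact heC (hm.eq_of_mem ((hCm _).mp hdb).1 he hbdb ht ▸ hdb)
  intro w hw
  have hza := hnea z hze
  have hwa := hnea w hw
  by_contra hwI
  rw [Finset.mem_Icc] at hwI
  have hzw : z ≠ w := by
    rintro rfl
    exact hwI hz'
  have hezw : e = {z, w} := (Finset.eq_of_subset_of_card_le
    (by simp [Finset.insert_subset_iff, hze, hw]) (by rw [hσ e he, Finset.card_pair hzw])).symm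
  rcases Nat.lt_or_ge w a with h | h
  · rw [hezw, Finset.pair_comm] at he heC
    have := hsep w z (by omega) he heC da hda db hdb a hada b hbdb (by omega) (by omega)
    omega
  · rw [hezw] at he heC
    have := hsep z w (by omega) he heC db hdb da hda b hbdb a hada (by omega) (by omega)
    omega

theorem connWeight_eq_zero {V : Type*} (G : SimpleGraph V) {R : Type*} [CommRing R] (y : R)
    {U : Finset V} (h : ¬ Joins (edgesIn G U) U) : connWeight G y U = 0 := by
  classical
  rw [connWeight, Finset.filter_false_of_mem, Finset.sum_empty]
  intro A hA hj
  refine h fun u hu v hv => (hj u hu v hv).mono (SimpleGraph.fromEdgeSet_mono ?_)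
  exact_mod_cast Finset.mem_powerset.mp hA

theorem mem_connectedMatchings {n : ℕ} {σ : Finpartition (Finset.Icc 1 (2 * n))} :
    σ ∈ connectedMatchings n ↔ IsMatching σ ∧ IsConnected σ := by
  classical
  simp [connectedMatchings]

/-- Matchings which are not connected have a disconnected crossing graph, hence do not
contribute. -/
theorem sum_connectedMatchings {R : Type*} [CommRing R] (q : R) (n : ℕ) :
    ∑ σ ∈ connectedMatchings n, connWeight crossGraph q σ.parts =
      matchingConnWeight q (Finset.Icc 1 (2 * n)) := by
  classical
  rw [matchingConnWeight, connectedMatchings, ← Finset.filter_filter,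
    Finset.sum_filter_of_ne]
  · refine Finset.sum_bij (fun σ _ => σ.parts) ?_ ?_ ?_ ?_
    · intro σ hσ
      exact mem_matchings.mpr (isMatchingOf_parts (Finset.mem_filter.mp hσ).2)
    · exact fun σ _ τ _ h => Finpartition.ext h
    · intro τ hτ
      rw [mem_matchings] at hτ
      refine ⟨⟨τ, Finset.supIndep_iff_pairwiseDisjoint.mpr hτ.disjoint,
        by rw [Finset.sup_eq_biUnion, hτ.biUnion_eq], fun h => ?_⟩, ?_, rfl⟩
      · simpa using hτ.card_eq _ h
      · exact Finset.mem_filter.mpr ⟨Finset.mem_univ _, hτ.card_eq⟩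
    · exact fun _ _ => rfl
  · intro σ hσ hne
    by_contra hcon
    exact hne (connWeight_eq_zero _ _ fun h =>
      hcon (isConnected_of_joins (Finset.mem_filter.mp hσ).2 h))

end ConnectedMatchings

/-! ### The Tutte polynomial at `x = 1` -/

section Tutte

theorem joins_univ_iff {V : Type*} [Fintype V] [Nonempty V] {A : Finset (Sym2 V)} :
    Joins A Finset.univ ↔ (SimpleGraph.fromEdgeSet (A : Set (Sym2 V))).Connected :=
  ⟨fun h => ⟨fun u v => h u (Finset.mem_univ u) v (Finset.mem_univ v)⟩,
    fun h u _ v _ => h.preconnected u v⟩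

open Classical in
/-- At `x = 1` only the connected spanning subgraphs contribute to the Tutte polynomial of a
connected graph. -/
theorem aeval_tutte_mul {V : Type*} [Fintype V] {G : SimpleGraph V} (hG : G.Connected)
    {R : Type*} [CommRing R] (q : R) :
    (q - 1) ^ (Fintype.card V - 1) * MvPolynomial.aeval ![(1 : R), q] (tutte G) =
      ∑ A ∈ G.edgeFinset.powerset with Joins A Finset.univ, (q - 1) ^ A.card := by
  have hV := hG.nonempty
  have hcard : 1 ≤ Fintype.card V := Fintype.card_pos
  have hrank : ∀ A : Set (Sym2 V), (SimpleGraph.fromEdgeSet A).Connected →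
      edgeRank A = Fintype.card V - 1 := by
    intro A hA
    have := hA.preconnected.subsingleton_connectedComponent
    have : Nat.card (SimpleGraph.fromEdgeSet A).ConnectedComponent = 1 :=
      Nat.card_eq_one_iff_unique.mpr ⟨this, ⟨SimpleGraph.connectedComponentMk _ hV.some⟩⟩
    rw [edgeRank, this]
  have hE : edgeRank G.edgeSet = Fintype.card V - 1 :=
    hrank _ (by rwa [SimpleGraph.fromEdgeSet_edgeSet])
  rw [tutte, map_sum, Finset.mul_sum, Finset.sum_filter]
  refine Finset.sum_congr rfl fun A _ => ?_
  simp only [map_mul, map_pow, map_sub, map_one, MvPolynomial.aeval_X, Matrix.cons_val_zero,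
    Matrix.cons_val_one, sub_self, hE]
  split_ifs with hA <;> rw [joins_univ_iff] at hA
  · have h1 := hA.card_vert_le_card_edgeSet_add_one
    have h2 : Nat.card (SimpleGraph.fromEdgeSet (A : Set (Sym2 V))).edgeSet ≤ A.card := by
      rw [SimpleGraph.edgeSet_fromEdgeSet, ← Set.ncard_coe_finset]
      exact Set.ncard_le_ncard Set.sdiff_subset
    rw [Nat.card_eq_fintype_card] at h1
    rw [hrank _ hA, Nat.sub_self, pow_zero, one_mul, ← pow_add]
    congr 1
    omega
  · have h1 : Nat.card (SimpleGraph.fromEdgeSet (A : Set (Sym2 V))).ConnectedComponent ≤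
        Fintype.card V := by
      rw [← Nat.card_eq_fintype_card]
      exact Nat.card_le_card_of_surjective
        (SimpleGraph.connectedComponentMk (SimpleGraph.fromEdgeSet (A : Set (Sym2 V))))
        Quot.mk_surjective
    have h2 : 1 < Nat.card (SimpleGraph.fromEdgeSet (A : Set (Sym2 V))).ConnectedComponent := by
      rw [Finite.one_lt_card_iff_nontrivial]
      by_contra hcon
      rw [not_nontrivial_iff_subsingleton] at hcon
      refine hA ⟨fun u v => SimpleGraph.ConnectedComponent.exact (Subsingleton.elim _ _)⟩
    rw [zero_pow, zero_mul, mul_zero]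
    rw [edgeRank]
    omega

variable {V : Type*}

/-- The inclusion of the unordered pairs of elements of `U` into those of `V`. -/
def sym2Subtype (U : Finset V) : Sym2 U ↪ Sym2 V := (Function.Embedding.subtype _).sym2Map

theorem mk_mem_map_sym2Subtype {U : Finset V} {A : Finset (Sym2 U)} {x y : U} :
    s(x.1, y.1) ∈ A.map (sym2Subtype U) ↔ s(x, y) ∈ A :=
  Finset.mem_map' (sym2Subtype U) (a := s(x, y))

theorem joins_map_iff {U : Finset V} (A : Finset (Sym2 U)) :
    Joins (A.map (sym2Subtype U)) U ↔ Joins A Finset.univ := by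
  constructor
  · intro h u _ v _
    refine (mem_of_reachable (p := fun w => ∃ hw : w ∈ U,
      (SimpleGraph.fromEdgeSet (A : Set (Sym2 U))).Reachable u ⟨w, hw⟩) ?_
      (h u u.2 v v.2) ⟨u.2, SimpleGraph.Reachable.rfl⟩).2
    rintro x y hxy ⟨hx, hr⟩
    rw [SimpleGraph.fromEdgeSet_adj, Finset.mem_coe] at hxy
    have hy : y ∈ U := by
      obtain ⟨e, _, he⟩ := Finset.mem_map.mp hxy.1
      induction e with | _ a b
      have : y ∈ s(x, y) := Sym2.mem_mk_right x y
      rw [← he] at this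
      change y ∈ s(a.1, b.1) at this
      rcases Sym2.mem_iff.mp this with rfl | rfl
      exacts [a.2, b.2]
    refine ⟨hy, hr.trans (SimpleGraph.Adj.reachable ?_)⟩
    rw [SimpleGraph.fromEdgeSet_adj]
    exact ⟨mk_mem_map_sym2Subtype.mp hxy.1, fun h => hxy.2 (congrArg Subtype.val h)⟩
  · intro h u hu v hv
    let f : SimpleGraph.fromEdgeSet (A : Set (Sym2 U)) →g
        SimpleGraph.fromEdgeSet ((A.map (sym2Subtype U) : Finset (Sym2 V)) : Set (Sym2 V)) :=
      ⟨Subtype.val, fun {x y} hxy => by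
        rw [SimpleGraph.fromEdgeSet_adj] at hxy ⊢
        exact ⟨mk_mem_map_sym2Subtype.mpr hxy.1, fun h => hxy.2 (Subtype.ext h)⟩⟩
    exact (h ⟨u, hu⟩ (Finset.mem_univ _) ⟨v, hv⟩ (Finset.mem_univ _)).map f

open Classical in
theorem edgesIn_eq_map (G : SimpleGraph V) (U : Finset V) :
    edgesIn G U = (G.comap (Subtype.val : U → V)).edgeFinset.map (sym2Subtype U) := by
  ext e
  induction e with | _ x y
  rw [mk_mem_edgesIn]
  constructor
  · rintro ⟨hx, hy, h⟩
    refine (mk_mem_map_sym2Subtype (x := ⟨x, hx⟩) (y := ⟨y, hy⟩)).mpr ?_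
    simpa using h
  · intro h
    obtain ⟨e, he, hxy⟩ := Finset.mem_map.mp h
    induction e with | _ a b
    change s(a.1, b.1) = s(x, y) at hxy
    rw [SimpleGraph.mem_edgeFinset, SimpleGraph.mem_edgeSet, SimpleGraph.comap_adj] at he
    rcases Sym2.eq_iff.mp hxy with ⟨rfl, rfl⟩ | ⟨rfl, rfl⟩
    exacts [⟨a.2, b.2, he⟩, ⟨b.2, a.2, he.symm⟩]

/-- The generating function of the connected spanning subgraphs of a connected induced subgraph is
a value of its Tutte polynomial. -/
theorem connWeight_eq_tutte (G : SimpleGraph V) {R : Type*} [CommRing R] (q : R) {U : Finset V}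
    (hU : U.Nonempty) (hj : Joins (edgesIn G U) U) : connWeight G q U =
      (q - 1) ^ (U.card - 1) *
        MvPolynomial.aeval ![(1 : R), q] (tutte (G.comap (Subtype.val : U → V))) := by
  classical
  have hG : (G.comap (Subtype.val : U → V)).Connected := by
    rw [edgesIn_eq_map] at hj
    have := hU.to_subtype
    have h := joins_univ_iff.mp ((joins_map_iff _).mp hj)
    rwa [SimpleGraph.coe_edgeFinset, SimpleGraph.fromEdgeSet_edgeSet] at h
  have h := aeval_tutte_mul hG q
  rw [Fintype.card_coe] at h
  rw [h, connWeight, edgesIn_eq_map]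
  symm
  refine Finset.sum_bij (fun A _ => A.map (sym2Subtype U)) ?_ ?_ ?_ ?_
  · intro A hA
    obtain ⟨hA, hj⟩ := Finset.mem_filter.mp hA
    exact Finset.mem_filter.mpr ⟨Finset.mem_powerset.mpr (Finset.map_subset_map.mpr
      (Finset.mem_powerset.mp hA)), (joins_map_iff A).mpr hj⟩
  · exact fun A _ B _ h => Finset.map_injective _ h
  · intro B hB
    obtain ⟨hB, hj⟩ := Finset.mem_filter.mp hB
    obtain ⟨A, hA, rfl⟩ := Finset.subset_map_iff.mp (Finset.mem_powerset.mp hB)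
    exact ⟨A, Finset.mem_filter.mpr ⟨Finset.mem_powerset.mpr hA, (joins_map_iff A).mp hj⟩, rfl⟩
  · exact fun A _ => by rw [Finset.card_map]

end Tutte

/-! ### Normalized cumulants -/

section Main

theorem card_parts {n : ℕ} {σ : Finpartition (Finset.Icc 1 (2 * n))} (hσ : IsMatching σ) :
    σ.parts.card = n := by
  have h := σ.sum_card_parts
  rw [Finset.sum_congr rfl hσ, Finset.sum_const, Nat.card_Icc, smul_eq_mul] at h
  omega

/-- The normalized cumulants count connected subgraphs of crossing graphs. -/
theorem pow_mul_normalizedCumulant {K : Type*} [Field K] [CharZero K] {q : K} (hq : q ≠ 1) {n : ℕ}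
    (hn : 1 ≤ n) : (q - 1) ^ (n - 1) * normalizedCumulant q n =
      ∑ σ ∈ connectedMatchings n, connWeight crossGraph q σ.parts := by
  rw [sum_connectedMatchings, matchingConnWeight_eq_cumulant hq _ ⟨1, by simp; omega⟩,
    Nat.card_Icc, Nat.add_sub_cancel, normalizedCumulant]
  exact mul_div_cancel₀ _ (pow_ne_zero _ (sub_ne_zero.mpr hq))

end Main
end QSemicircular

theorem theorem3p3 (n : ℕ) (hn : 1 ≤ n) :
    (∀ (K : Type*) [Field K] [CharZero K] (q : K), q ≠ 1 →
      QSemicircular.normalizedCumulant q n =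
        ∑ σ ∈ QSemicircular.connectedMatchings n,
          MvPolynomial.aeval ![(1 : K), q] (QSemicircular.tutte (QSemicircular.crossingGraph σ))) ∧
    ∃ P : Polynomial ℤ, (∀ i : ℕ, 0 ≤ P.coeff i) ∧
      ∀ (K : Type*) [Field K] [CharZero K] (q : K), q ≠ 1 →
        QSemicircular.normalizedCumulant q n = Polynomial.aeval q P := by
  open QSemicircular in
  have hparts : ∀ σ ∈ connectedMatchings n, IsMatching σ ∧ IsConnected σ ∧ σ.parts.card = n ∧
      σ.parts.Nonempty := by
    intro σ hσ
    obtain ⟨h1, h2⟩ := mem_connectedMatchings.mp hσ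
    have h3 := card_parts h1
    exact ⟨h1, h2, h3, Finset.card_pos.mp (by omega)⟩
  constructor
  · intro K _ _ q hq
    have hq1 : (q - 1) ^ (n - 1) ≠ 0 := pow_ne_zero _ (sub_ne_zero.mpr hq)
    refine mul_left_cancel₀ hq1 ?_
    rw [pow_mul_normalizedCumulant hq hn, Finset.mul_sum]
    refine Finset.sum_congr rfl fun σ hσ => ?_
    obtain ⟨hM, hC, hcard, hne⟩ := hparts σ hσ
    rw [connWeight_eq_tutte crossGraph q hne (joins_of_isConnected (by omega) hM hC), hcard]
    rfl
  · have hex : ∀ σ : Finpartition (Finset.Icc 1 (2 * n)), ∃ P : Polynomial ℕ,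
        σ ∈ connectedMatchings n → ∀ (K : Type _) [CommRing K] (q : K),
          connWeight crossGraph q σ.parts = (q - 1) ^ (n - 1) * Polynomial.aeval q P := by
      intro σ
      by_cases hσ : σ ∈ connectedMatchings n
      · obtain ⟨-, -, hcard, hne⟩ := hparts σ hσ
        obtain ⟨P, hP⟩ := exists_connWeight_eq crossGraph hne
        exact ⟨P, fun _ K _ q => by rw [hP, hcard]⟩
      · exact ⟨0, fun h => absurd h hσ⟩
    choose P hP using hex
    refine ⟨(∑ σ ∈ connectedMatchings n, P σ).map (Nat.castRingHom ℤ), fun i => ?_, ?_⟩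
    · rw [Polynomial.coeff_map]
      exact Int.natCast_nonneg _
    · intro K _ _ q hq
      have hq1 : (q - 1) ^ (n - 1) ≠ 0 := pow_ne_zero _ (sub_ne_zero.mpr hq)
      refine mul_left_cancel₀ hq1 ?_
      have hmap : ∀ p : Polynomial ℕ,
          Polynomial.aeval q (p.map (Nat.castRingHom ℤ)) = Polynomial.aeval q p :=
        fun p => Polynomial.aeval_map_algebraMap ℤ q p
      rw [pow_mul_normalizedCumulant hq hn, hmap, map_sum, Finset.mul_sum]
      exact Finset.sum_congr rfl fun σ hσ => hP σ hσ K q
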